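/- **Setting.** Fix an infinite set $\mathsf{Nodes}$ of nodes and a label set $L$: a partial order with least element $\bot$ in which every nonempty directed set has a supremum and every element has only finitely many elements below it. Formulae are generated by $\psi ::= \mathsf{true}\mid\mathsf{false}\mid\psi\wedge\psi\mid\psi\vee\psi\mid\neg\psi\mid x$ with $x\in\mathsf{Nodes}$, and are compared syntactically. An *lpof* is $\alpha=\langle N,<,\lambda,\varphi\rangle$ where $N\subseteq\mathsf{Nodes}$ is countable; $<$ is a strict partial order on $N$ such that each node has finitely many predecessors, each level is finite, and there is exactly one minimal node; $\lambda:N\to L$ is such that a node labelled $\bot$ has no successor; and $\varphi$ maps each node $x$ to a satisfiable formula with variables in $\{y\mid y<x\}$, such that $\varphi(y)\Rightarrow\varphi(x)$ whenever $x<y$. (The level of $x$ is the largest length of a path of immediate successors from a minimal node to $x$.) Write $\alpha\sqsubseteq\beta$ if $N_\alpha$ is a downward closed subset of $N_\beta$, $<_\alpha$ is the restriction of $<_\beta$ to $N_\alpha$, and for all $x\in N_\alpha$: $\lambda_\alpha(x)\le\lambda_\beta(x)$, $\varphi_\alpha(x)=\varphi_\beta(x)$, and the immediate successors of $x$ in $\alpha$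 are the immediate successors of $x$ in $\beta$ that are not $>_\beta$ some node $z\in N_\alpha$ with $\lambda_\alpha(z)=\bot$. A *pomset* is a class $A=[\alpha]$ of lpofs up to bijective renaming of nodes (variables of formulae are renamed accordingly). Put $A\sqsubseteq B$ iff every $\beta\in B$ has some $\alpha\in A$ with $\alpha\sqsubseteq\beta$; equivalently, $\alpha\sqsubseteq\beta$ for some $\alpha\in A$ and $\beta\in B$. This is a partial order. Write $A'\ll A$ if $A'$ is finite and $A'\sqsubseteq A$. Let $\langle\bot\rangle$ be the pomset with a single node, label $\bot$ and formula $\mathsf{true}$. Let $\ell\in L$, $\ell\ne\bot$. For lpofs $\alpha,\beta$ with disjoint node sets and $x\notin N_\alpha\cup N_\beta$, let $\mathsf{guard}(x,\ell,\alpha,\beta)$ be the lpof with nodes $\{x\}\cup N_\alpha\cup N_\beta$; order $<_\alpha\cup<_\beta\cup(\{x\}\times(N_\alpha\cup N_\beta))$; label $\ell$ at $x$ and the labels of $\alpha,\beta$ elsewhere; formula $\mathsf{true}$ at $x$, $\varphi_\alpha(y)\wedge x$ at $y\in N_\alpha$, and $\varphi_\beta(y)\wedge\neg x$ at $y\in N_\beta$.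 For finite pomsets $A,B$ let $\mathsf{guard}(\ell,A,B)$ be the pomset of all $\mathsf{guard}(x,\ell,\alpha,\beta)$ with $\alpha\in A$, $\beta\in B$, $N_\alpha\cap N_\beta=\emptyset$, $x\notin N_\alpha\cup N_\beta$. For arbitrary pomsets let $$\mathsf{guard}(\ell,A,B)=\sup_{A'\ll A}\ \sup_{B'\ll B}\ \mathsf{guard}(\ell,A',B').$$ **Statement.** 1. Every nonempty directed set of pomsets has a supremum. 2. (Monotonicity) For finite pomsets, if $A\sqsubseteq A'$ and $B\sqsubseteq B'$ then $\mathsf{guard}(\ell,A,B)\sqsubseteq\mathsf{guard}(\ell,A',B')$. 3. All suprema in the definition of $\mathsf{guard}$ on arbitrary pomsets exist, and for finite $A,B$ the two definitions of $\mathsf{guard}(\ell,A,B)$ agree. 4. (Scott continuity) The map $(A,B)\mapsto\mathsf{guard}(\ell,A,B)$ on pairs of pomsets, ordered componentwise, is Scott continuous: it is monotone and preserves suprema of nonempty directed sets. 5. (Loops) For every Scott continuous map $F$ from pomsets to pomsets and every pomset $K$, the map $\Phi(X)=\mathsf{guard}(\ell,F(X),K)$ is Scott continuous and has a least fixed point,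 which is $\sup_{n\in\mathbb N}\Phi^n(\langle\bot\rangle)$. -/

import Mathlib

/-! Labelled partial orders with formulae, pomsets with formulae, and guarded choice. -/

set_option linter.unusedSectionVars false

namespace PomF

universe u v

/-- Boolean formulae over a set `V` of variables. -/
inductive Form (V : Type u) : Type u
  | tt : Form V
  | ff : Form V
  | conj : Form V → Form V → Form V
  | disj : Form V → Form V → Form V
  | neg : Form V → Form V
  | var : V → Form V

namespace Form

variable {V : Type u}

/-- Satisfaction `v ⊨ ψ`. -/
def Holds (v : V → Bool) : Form V → Prop
  | tt => True
  | ff => False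
  | conj p q => Holds v p ∧ Holds v q
  | disj p q => Holds v p ∨ Holds v q
  | neg p => ¬ Holds v p
  | var x => v x = true

/-- The variables that appear in a formula. -/
def free : Form V → Set V
  | tt => ∅
  | ff => ∅
  | conj p q => free p ∪ free q
  | disj p q => free p ∪ free q
  | neg p => free p
  | var x => {x}

/-- Renaming of variables. -/
def rename (f : V → V) : Form V → Form V
  | tt => tt
  | ff => ff
  | conj p q => conj (rename f p) (rename f q)
  | disj p q => disj (rename f p) (rename f q)
  | neg p => neg (rename f p)
  | var x => var (f x)

/-- Satisfiability. -/
def Sat (p : Form V) : Prop := ∃ v : V → Bool, Holds v p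

/-- Semantic implication. -/
def Entails (p q : Form V) : Prop := ∀ v : V → Bool, Holds v p → Holds v q

theorem holds_congr {v w : V → Bool} (p : Form V) (h : ∀ x ∈ free p, v x = w x) :
    Holds v p ↔ Holds w p := by
  induction p with
  | tt => simp [Holds]
  | ff => simp [Holds]
  | conj p q hp hq =>
    simp only [free, Set.mem_union] at h
    simp only [Holds, hp fun x hx => h x (Or.inl hx), hq fun x hx => h x (Or.inr hx)]
  | disj p q hp hq =>
    simp only [free, Set.mem_union] at h
    simp only [Holds, hp fun x hx => h x (Or.inl hx), hq fun x hx => h x (Or.inr hx)]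
  | neg p hp => simp only [Holds, hp h]
  | var x => simp [Holds, h x (by simp [free])]

theorem holds_rename (v : V → Bool) (f : V → V) (p : Form V) :
    Holds v (rename f p) ↔ Holds (v ∘ f) p := by
  induction p with
  | tt => simp [Holds, rename]
  | ff => simp [Holds, rename]
  | conj p q hp hq => simp [Holds, rename, hp, hq]
  | disj p q hp hq => simp [Holds, rename, hp, hq]
  | neg p hp => simp [Holds, rename, hp]
  | var x => simp [Holds, rename]

theorem free_rename (f : V → V) (p : Form V) : free (rename f p) = f '' free p := by
  induction p with
  | tt => simp [free, rename]
  | ff => simp [free, rename]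
  | conj p q hp hq => simp [free, rename, hp, hq, Set.image_union]
  | disj p q hp hq => simp [free, rename, hp, hq, Set.image_union]
  | neg p hp => simp [free, rename, hp]
  | var x => simp [free, rename]

theorem rename_congr {f g : V → V} (p : Form V) (h : ∀ x ∈ free p, f x = g x) :
    rename f p = rename g p := by
  induction p with
  | tt => rfl
  | ff => rfl
  | conj p q hp hq =>
    simp only [free, Set.mem_union] at h
    simp only [rename, hp fun x hx => h x (Or.inl hx), hq fun x hx => h x (Or.inr hx)]
  | disj p q hp hq =>
    simp only [free, Set.mem_union] at h
    simp only [rename, hp fun x hx => h x (Or.inl hx), hq fun x hx => h x (Or.inr hx)]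
  | neg p hp => simp only [rename, hp h]
  | var x => simp [rename, h x (by simp [free])]

theorem rename_rename (f g : V → V) (p : Form V) :
    rename g (rename f p) = rename (g ∘ f) p := by
  induction p with
  | tt => rfl
  | ff => rfl
  | conj p q hp hq => simp [rename, hp, hq]
  | disj p q hp hq => simp [rename, hp, hq]
  | neg p hp => simp [rename, hp]
  | var x => rfl

theorem rename_id (p : Form V) : rename (fun x => x) p = p := by
  induction p with
  | tt => rfl
  | ff => rfl
  | conj p q hp hq => simp [rename, hp, hq]
  | disj p q hp hq => simp [rename, hp, hq]
  | neg p hp => simp [rename, hp]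
  | var x => rfl

end Form

/-- The data `⟨N, <, λ, φ⟩` of a labelled partial order with formulae. The functions `label` and
`form` are total; their values outside `nodes` are normalised in `IsLPOF`. -/
@[ext]
structure PreLPOF (Node : Type u) (L : Type v) where
  nodes : Set Node
  lt : Node → Node → Prop
  label : Node → L
  form : Node → Form Node

namespace PreLPOF

variable {Node : Type u} {L : Type v}

/-- All nodes strictly above `x`. -/
def above (α : PreLPOF Node L) (x : Node) : Set Node := {y | α.lt x y}

/-- All nodes strictly below `x`. -/
def below (α : PreLPOF Node L) (x : Node) : Set Node := {y | α.lt y x}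

/-- All nodes strictly above some element of `X`. -/
def aboveSet (α : PreLPOF Node L) (X : Set Node) : Set Node := ⋃ x ∈ X, α.above x

/-- Immediate successors. -/
def succ (α : PreLPOF Node L) (x : Node) : Set Node :=
  {y | y ∈ α.above x ∧ ¬ ∃ z, α.lt x z ∧ α.lt z y}

/-- Immediate predecessors. -/
def pred (α : PreLPOF Node L) (x : Node) : Set Node :=
  {y | y ∈ α.below x ∧ ¬ ∃ z, α.lt y z ∧ α.lt z x}

/-- Minimal nodes. -/
def mins (α : PreLPOF Node L) : Set Node := {x | x ∈ α.nodes ∧ α.pred x = ∅}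

/-- There is a path `x₀, …, xₙ = x` of immediate successors that starts in a minimal node. -/
def PathTo (α : PreLPOF Node L) (x : Node) (n : ℕ) : Prop :=
  ∃ c : ℕ → Node, c 0 ∈ α.mins ∧ c n = x ∧ ∀ i < n, c (i + 1) ∈ α.succ (c i)

/-- The level of a node. -/
noncomputable def lev (α : PreLPOF Node L) (x : Node) : ℕ := sSup {n | α.PathTo x n}

/-- The nodes labelled with `⊥`. -/
def bots [Bot L] (α : PreLPOF Node L) : Set Node := {x | x ∈ α.nodes ∧ α.label x = ⊥}

/-- The axioms of a labelled partial order with formulae. -/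
structure IsLPOF [PartialOrder L] [OrderBot L] (α : PreLPOF Node L) : Prop where
  lt_mem : ∀ x y, α.lt x y → x ∈ α.nodes ∧ y ∈ α.nodes
  label_off : ∀ x, x ∉ α.nodes → α.label x = ⊥
  form_off : ∀ x, x ∉ α.nodes → α.form x = Form.tt
  countable : α.nodes.Countable
  irrefl : ∀ x, ¬ α.lt x x
  trans : ∀ x y z, α.lt x y → α.lt y z → α.lt x z
  finite_below : ∀ x ∈ α.nodes, (α.below x).Finite
  finite_level : ∀ n : ℕ, {x | x ∈ α.nodes ∧ α.lev x = n}.Finite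
  single_root : ∃! r, r ∈ α.mins
  bot_succ : ∀ x ∈ α.nodes, α.label x = ⊥ → α.succ x = ∅
  form_sat : ∀ x ∈ α.nodes, (α.form x).Sat
  form_free : ∀ x ∈ α.nodes, (α.form x).free ⊆ α.below x
  form_entails : ∀ x y, α.lt x y → (α.form y).Entails (α.form x)

/-- The order on labelled partial orders with formulae. -/
structure Le [PartialOrder L] [OrderBot L] (α β : PreLPOF Node L) : Prop where
  subset : α.nodes ⊆ β.nodes
  down : ∀ y ∈ α.nodes, β.below y ⊆ α.nodes
  lt_iff : ∀ x y, α.lt x y ↔ β.lt x y ∧ x ∈ α.nodes ∧ y ∈ α.nodes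
  label_le : ∀ x ∈ α.nodes, α.label x ≤ β.label x
  form_eq : ∀ x ∈ α.nodes, α.form x = β.form x
  succ_eq : ∀ x ∈ α.nodes, α.succ x = β.succ x \ β.aboveSet α.bots

/-- `f` restricts to a bijection from the nodes of `α` to the nodes of `β` that carries the order,
the labels and the formulae of `α` to those of `β`. -/
structure IsoVia (f : Node → Node) (α β : PreLPOF Node L) : Prop where
  bij : Set.BijOn f α.nodes β.nodes
  lt_iff : ∀ x ∈ α.nodes, ∀ y ∈ α.nodes, (β.lt (f x) (f y) ↔ α.lt x y)
  label_eq : ∀ x ∈ α.nodes, β.label (f x) = α.label x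
  form_eq : ∀ x ∈ α.nodes, β.form (f x) = (α.form x).rename f

/-- The one-node structure with node `x` and label `ℓ`. -/
noncomputable def single [Bot L] (x : Node) (ℓ : L) : PreLPOF Node L where
  nodes := {x}
  lt := fun _ _ => False
  label := open Classical in fun y => if y = x then ℓ else ⊥
  form := fun _ => Form.tt

/-- Guarded choice with test node `x` labelled `ℓ` and branches `α` and `β`. -/
noncomputable def guard [Bot L] (x : Node) (ℓ : L) (α β : PreLPOF Node L) : PreLPOF Node L where
  nodes := {x} ∪ α.nodes ∪ β.nodes
  lt := fun y z => α.lt y z ∨ β.lt y z ∨ (y = x ∧ z ∈ α.nodes ∪ β.nodes)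
  label := open Classical in fun y =>
    if y = x then ℓ else if y ∈ α.nodes then α.label y else if y ∈ β.nodes then β.label y else ⊥
  form := open Classical in fun y =>
    if y = x then Form.tt
    else if y ∈ α.nodes then Form.conj (α.form y) (Form.var x)
    else if y ∈ β.nodes then Form.conj (β.form y) (Form.neg (Form.var x))
    else Form.tt

/-- The image of a structure under a renaming of nodes that is injective on its nodes. -/
noncomputable def image [Bot L] (f : Node → Node) (α : PreLPOF Node L) : PreLPOF Node L where
  nodes := f '' α.nodes
  lt := fun y z => ∃ a b, α.lt a b ∧ f a = y ∧ f b = z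
  label := open Classical in fun y =>
    if h : ∃ a ∈ α.nodes, f a = y then α.label h.choose else ⊥
  form := open Classical in fun y =>
    if h : ∃ a ∈ α.nodes, f a = y then (α.form h.choose).rename f else Form.tt

section facts

variable [PartialOrder L] [OrderBot L] {α β γ : PreLPOF Node L}

theorem PathTo.le_ncard (hi : ∀ x, ¬ α.lt x x) (ht : ∀ x y z, α.lt x y → α.lt y z → α.lt x z)
    {x : Node} (hx : (α.below x).Finite) {n : ℕ} (h : α.PathTo x n) :
    n ≤ (α.below x).ncard := by
  obtain ⟨c, -, rfl, hc⟩ := h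
  have key : ∀ j, j ≤ n → ∀ i < j, α.lt (c i) (c j) := by
    intro j
    induction j with
    | zero => intro _ i hi; omega
    | succ j ih =>
      intro hj i hij
      have h1 : α.lt (c j) (c (j + 1)) := (hc j (by omega)).1
      rcases Nat.lt_succ_iff_lt_or_eq.1 hij with h | rfl
      · exact ht _ _ _ (ih (by omega) i h) h1
      · exact h1
  have hinj : Set.InjOn c (Finset.range n : Set ℕ) := by
    intro i hi' j hj' hij
    simp only [Finset.coe_range, Set.mem_Iio] at hi' hj'
    rcases lt_trichotomy i j with h | h | h
    · exact absurd (hij ▸ key j (by omega) i h) (hi _)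
    · exact h
    · exact absurd (hij ▸ key i (by omega) j h) (hi _)
  have := Set.ncard_le_ncard (s := c '' (Finset.range n : Set ℕ)) (t := α.below (c n))
    (by
      rintro _ ⟨i, hi', rfl⟩
      simp only [Finset.coe_range, Set.mem_Iio] at hi'
      exact key n le_rfl i hi') hx
  rwa [hinj.ncard_image, Set.ncard_coe_finset, Finset.card_range] at this

theorem lev_le_ncard (hi : ∀ x, ¬ α.lt x x) (ht : ∀ x y z, α.lt x y → α.lt y z → α.lt x z)
    {x : Node} (hx : (α.below x).Finite) : α.lev x ≤ (α.below x).ncard :=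
  csSup_le' fun _ hn => PathTo.le_ncard hi ht hx hn

theorem lev_le_lev (hi : ∀ x, ¬ β.lt x x) (ht : ∀ x y z, β.lt x y → β.lt y z → β.lt x z)
    {x y : Node} (hy : (β.below y).Finite)
    (h : ∀ n, α.PathTo x n → ∃ m, n ≤ m ∧ β.PathTo y m) : α.lev x ≤ β.lev y := by
  refine csSup_le' fun n hn => ?_
  obtain ⟨m, hnm, hm⟩ := h n hn
  exact hnm.trans (le_csSup ⟨_, fun k hk => PathTo.le_ncard hi ht hy hk⟩ hm)

theorem IsLPOF.finite_level_le (hα : α.IsLPOF) (n : ℕ) :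
    {x | x ∈ α.nodes ∧ α.lev x ≤ n}.Finite := by
  refine ((Set.finite_Iic n).biUnion fun k _ => hα.finite_level k).subset ?_
  rintro x ⟨hx, hn⟩
  simp only [Set.mem_iUnion, Set.mem_Iic]
  exact ⟨_, hn, hx, rfl⟩

/-- In a finitely preceded order, a property of nodes holds by induction on smaller nodes. -/
theorem IsLPOF.induct (hα : α.IsLPOF) {P : Node → Prop}
    (h : ∀ x ∈ α.nodes, (∀ y, α.lt y x → P y) → P x) : ∀ x ∈ α.nodes, P x := by
  suffices H : ∀ n : ℕ, ∀ x ∈ α.nodes, (α.below x).ncard < n → P x from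
    fun x hx => H _ x hx (Nat.lt_succ_self _)
  intro n
  induction n with
  | zero => intro x _ hn; omega
  | succ n ih =>
    intro x hx hn
    refine h x hx fun y hy => ih y (hα.lt_mem _ _ hy).1 ?_
    refine lt_of_lt_of_le (Set.ncard_lt_ncard ?_ (hα.finite_below x hx)) (Nat.lt_succ_iff.1 hn)
    refine ⟨fun z hz => hα.trans _ _ _ hz hy, fun hs => hα.irrefl y (hs hy)⟩

/-- A node that is not minimal has an immediate predecessor. -/
theorem IsLPOF.exists_pred (hα : α.IsLPOF) {z x : Node} (h : α.lt z x) :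
    ∃ w, x ∈ α.succ w := by
  by_contra! hne
  have hx := (hα.lt_mem _ _ h).2
  have : ∀ n : ℕ, ∀ z, α.lt z x → (α.below x \ α.below z).ncard < n → False := by
    intro n
    induction n with
    | zero => intro z _ hn; omega
    | succ n ih =>
      intro z hz hn
      have hz' := hne z
      simp only [succ, above, Set.mem_ofPred_eq, not_and, not_not] at hz'
      obtain ⟨w, hzw, hwx⟩ := hz' hz
      refine ih w hwx (lt_of_lt_of_le (Set.ncard_lt_ncard ?_ ?_) (Nat.lt_succ_iff.1 hn))
      · refine ⟨fun t ht => ⟨ht.1, fun hh => ht.2 (hα.trans _ _ _ hh hzw)⟩, fun hs => ?_⟩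
        exact (hs ⟨hz, hα.irrefl z⟩).2 hzw
      · exact (hα.finite_below x hx).subset fun t ht => ht.1
  exact this _ z h (Nat.lt_succ_self _)

theorem IsLPOF.mem_mins_iff (hα : α.IsLPOF) {x : Node} :
    x ∈ α.mins ↔ x ∈ α.nodes ∧ ∀ y, ¬ α.lt y x := by
  refine ⟨fun h => ⟨h.1, fun y hy => ?_⟩, fun h => ⟨h.1, ?_⟩⟩
  · obtain ⟨w, hw⟩ := hα.exists_pred hy
    have : w ∈ α.pred x := hw
    rw [h.2] at this
    exact this
  · ext y
    simp only [Set.mem_empty_iff_false, iff_false]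
    exact fun hy => h.2 y hy.1

theorem IsLPOF.nodes_nonempty (hα : α.IsLPOF) : α.nodes.Nonempty :=
  let ⟨r, hr, _⟩ := hα.single_root
  ⟨r, hr.1⟩

theorem Le.aboveSet_eq (hα : α.IsLPOF) (hβ : β.IsLPOF) (h : α.Le β) :
    β.nodes \ α.nodes = β.aboveSet α.bots := by
  obtain ⟨r, hr, hru⟩ := hβ.single_root
  have hroot : ∀ x ∈ β.nodes, x = r ∨ β.lt r x := by
    refine hβ.induct fun x hx ih => ?_
    by_cases hm : x ∈ β.mins
    · exact Or.inl (hru x hm)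
    · rw [hβ.mem_mins_iff] at hm
      push Not at hm
      obtain ⟨y, hy⟩ := hm hx
      rcases ih y hy with rfl | h'
      · exact Or.inr hy
      · exact Or.inr (hβ.trans _ _ _ h' hy)
  have hrα : r ∈ α.nodes := by
    obtain ⟨a, ha⟩ := hα.nodes_nonempty
    rcases hroot a (h.subset ha) with rfl | h'
    · exact ha
    · exact h.down a ha h'
  ext x
  constructor
  · rintro ⟨hx, hxα⟩
    revert hxα
    revert x
    refine hβ.induct fun x hx ih hxα => ?_
    have hrx : β.lt r x := by
      rcases hroot x hx with rfl | h'
      · exact absurd hrα hxα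
      · exact h'
    obtain ⟨w, hw⟩ := hβ.exists_pred hrx
    by_cases hwα : w ∈ α.nodes
    · by_contra hcon
      have : x ∈ α.succ w := by rw [h.succ_eq w hwα]; exact ⟨hw, hcon⟩
      exact hxα (hα.lt_mem _ _ this.1).2
    · have := ih w hw.1 hwα
      simp only [aboveSet, Set.mem_iUnion] at this ⊢
      obtain ⟨b, hb, hbw⟩ := this
      exact ⟨b, hb, hβ.trans _ _ _ hbw hw.1⟩
  · intro hx
    simp only [aboveSet, Set.mem_iUnion] at hx
    obtain ⟨b, hb, hbx⟩ := hx
    refine ⟨(hβ.lt_mem _ _ hbx).2, fun hxα => ?_⟩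
    have h1 : α.lt b x := (h.lt_iff b x).2 ⟨hbx, hb.1, hxα⟩
    have h2 : ∃ y, y ∈ α.succ b := by
      by_contra! hne
      have : ∀ x ∈ α.nodes, α.lt b x → False := by
        refine hα.induct fun x hx ih hbx => ?_
        have := hne x
        simp only [succ, above, Set.mem_ofPred_eq, not_and, not_not] at this
        obtain ⟨z, hbz, hzx⟩ := this hbx
        exact ih z hzx hbz
      exact this x hxα h1
    obtain ⟨y, hy⟩ := h2
    rw [hα.bot_succ b hb.1 hb.2] at hy
    exact hy

theorem Le.refl (hα : α.IsLPOF) : α.Le α where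
  subset := le_rfl
  down := fun _ _ _ hz => (hα.lt_mem _ _ hz).1
  lt_iff := fun x y => ⟨fun h => ⟨h, hα.lt_mem _ _ h⟩, fun h => h.1⟩
  label_le := fun _ _ => le_rfl
  form_eq := fun _ _ => rfl
  succ_eq := fun x _ => by
    symm
    rw [sdiff_eq_left, Set.disjoint_left]
    intro y hy hy'
    simp only [aboveSet, Set.mem_iUnion] at hy'
    obtain ⟨b, hb, hby⟩ := hy'
    have : ∀ y ∈ α.nodes, α.lt b y → False := by
      refine hα.induct fun y hy ih hby => ?_
      have h' : y ∉ α.succ b := by rw [hα.bot_succ b hb.1 hb.2]; exact fun h => h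
      simp only [succ, above, Set.mem_ofPred_eq, not_and, not_not] at h'
      obtain ⟨z, hbz, hzy⟩ := h' hby
      exact ih z hzy hbz
    exact this y (hα.lt_mem _ _ hby).2 hby

theorem Le.trans (hα : α.IsLPOF) (hβ : β.IsLPOF) (hγ : γ.IsLPOF) (h : α.Le β) (h' : β.Le γ) :
    α.Le γ := by
  have hsub := h.subset.trans h'.subset
  have hlt : ∀ x y, α.lt x y ↔ γ.lt x y ∧ x ∈ α.nodes ∧ y ∈ α.nodes := fun x y => by
    rw [h.lt_iff, h'.lt_iff]
    exact ⟨fun ⟨⟨a, _⟩, b⟩ => ⟨a, b⟩, fun ⟨a, b⟩ => ⟨⟨a, h.subset b.1, h.subset b.2⟩, b⟩⟩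
  refine ⟨hsub, ?_, hlt, fun x hx => (h.label_le x hx).trans (h'.label_le x (h.subset hx)),
    fun x hx => (h.form_eq x hx).trans (h'.form_eq x (h.subset hx)), fun x hx => ?_⟩
  · intro y hy z hz
    have hzβ := h'.down y (h.subset hy) hz
    exact h.down y hy ((h'.lt_iff z y).2 ⟨hz, hzβ, h.subset hy⟩)
  · rw [h.succ_eq x hx, h'.succ_eq x (h.subset hx), ← Le.aboveSet_eq hα hβ h,
      ← Le.aboveSet_eq hβ hγ h']
    ext y
    constructor
    · rintro ⟨⟨h1, h2⟩, h3⟩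
      refine ⟨h1, fun h4 => ?_⟩
      have hyγ : y ∈ γ.nodes := (hγ.lt_mem _ _ h1.1).2
      have hyβ : y ∈ β.nodes := by_contra fun hh => h2 ⟨hyγ, hh⟩
      have hyα : y ∈ α.nodes := by_contra fun hh => h3 ⟨hyβ, hh⟩
      simp only [aboveSet, Set.mem_iUnion] at h4
      obtain ⟨b, hb, hby⟩ := h4
      have h5 : y ∈ β.aboveSet α.bots := by
        simp only [aboveSet, Set.mem_iUnion]
        exact ⟨b, hb, (h'.lt_iff b y).2 ⟨hby, h.subset hb.1, hyβ⟩⟩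
      rw [← Le.aboveSet_eq hα hβ h] at h5
      exact h5.2 hyα
    · rintro ⟨h1, h2⟩
      have hyγ : y ∈ γ.nodes := (hγ.lt_mem _ _ h1.1).2
      have hyβ : y ∈ β.nodes := by
        by_contra hyβ
        have h3 : y ∈ γ.aboveSet β.bots := by
          rw [← Le.aboveSet_eq hβ hγ h']; exact ⟨hyγ, hyβ⟩
        simp only [aboveSet, Set.mem_iUnion] at h3
        obtain ⟨b, hb, hby⟩ := h3
        apply h2
        simp only [aboveSet, Set.mem_iUnion]
        by_cases hbα : b ∈ α.nodes
        · exact ⟨b, ⟨hbα, le_bot_iff.1 ((h.label_le b hbα).trans hb.2.le)⟩, hby⟩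
        · have h4 : b ∈ β.aboveSet α.bots := by
            rw [← Le.aboveSet_eq hα hβ h]; exact ⟨hb.1, hbα⟩
          simp only [aboveSet, Set.mem_iUnion] at h4
          obtain ⟨a, ha, hab⟩ := h4
          exact ⟨a, ha, hγ.trans _ _ _ ((h'.lt_iff a b).1 hab).1 hby⟩
      refine ⟨⟨h1, fun hh => hh.2 hyβ⟩, fun hh => h2 ?_⟩
      rw [Le.aboveSet_eq hα hβ h] at hh
      simp only [aboveSet, Set.mem_iUnion] at hh ⊢
      obtain ⟨b, hb, hby⟩ := hh
      exact ⟨b, hb, ((h'.lt_iff b y).1 hby).1⟩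

theorem Le.antisymm (hα : α.IsLPOF) (hβ : β.IsLPOF) (h : α.Le β) (h' : β.Le α) : α = β := by
  have hn : α.nodes = β.nodes := h.subset.antisymm h'.subset
  ext x y
  · rw [hn]
  · exact ⟨fun hxy => ((h.lt_iff x y).1 hxy).1, fun hxy => ((h'.lt_iff x y).1 hxy).1⟩
  · by_cases hx : x ∈ α.nodes
    · exact (h.label_le x hx).antisymm (h'.label_le x (hn ▸ hx))
    · rw [hα.label_off x hx, hβ.label_off x (hn ▸ hx)]
  · by_cases hx : x ∈ α.nodes
    · exact h.form_eq x hx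
    · rw [hα.form_off x hx, hβ.form_off x (hn ▸ hx)]

theorem IsoVia.refl (α : PreLPOF Node L) : IsoVia (fun x => x) α α :=
  ⟨Set.bijOn_id _, fun _ _ _ _ => Iff.rfl, fun _ _ => rfl, fun _ _ => (Form.rename_id _).symm⟩

theorem IsLPOF.free_subset (hα : α.IsLPOF) {x : Node} (hx : x ∈ α.nodes) :
    (α.form x).free ⊆ α.nodes :=
  fun _ hy => (hα.lt_mem _ _ (hα.form_free x hx hy)).1

theorem IsoVia.symm (hα : α.IsLPOF) {f : Node → Node} (h : IsoVia f α β) :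
    ∃ g, IsoVia g β α := by
  classical
  obtain ⟨r, hr⟩ := hα.nodes_nonempty
  have : Nonempty Node := ⟨r⟩
  have hinv := h.bij.invOn_invFunOn
  have hb : Set.BijOn (Function.invFunOn f α.nodes) β.nodes α.nodes :=
    (Set.bijOn_comm hinv).2 h.bij
  refine ⟨_, hb, fun x hx y hy => ?_, fun x hx => ?_, fun x hx => ?_⟩
  · rw [← h.lt_iff _ (hb.mapsTo hx) _ (hb.mapsTo hy), hinv.2 hx, hinv.2 hy]
  · rw [← h.label_eq _ (hb.mapsTo hx), hinv.2 hx]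
  · conv_rhs => rw [← hinv.2 hx]
    rw [h.form_eq _ (hb.mapsTo hx), Form.rename_rename]
    conv_lhs => rw [← Form.rename_id (α.form _)]
    exact Form.rename_congr _ fun y hy => (hinv.1 (hα.free_subset (hb.mapsTo hx) hy)).symm

theorem IsoVia.trans {f g : Node → Node} (h : IsoVia f α β) (h' : IsoVia g β γ) :
    IsoVia (g ∘ f) α γ where
  bij := h'.bij.comp h.bij
  lt_iff := fun x hx y hy => by
    rw [Function.comp, Function.comp, h'.lt_iff _ (h.bij.mapsTo hx) _ (h.bij.mapsTo hy),
      h.lt_iff x hx y hy]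
  label_eq := fun x hx => by
    rw [Function.comp, h'.label_eq _ (h.bij.mapsTo hx), h.label_eq x hx]
  form_eq := fun x hx => by
    rw [Function.comp, h'.form_eq _ (h.bij.mapsTo hx), h.form_eq x hx, Form.rename_rename]

theorem image_label {f : Node → Node} (hf : Set.InjOn f α.nodes) {a : Node} (ha : a ∈ α.nodes) :
    (α.image f).label (f a) = α.label a := by
  have h : ∃ b ∈ α.nodes, f b = f a := ⟨a, ha, rfl⟩
  simp only [image, dif_pos h]
  rw [hf h.choose_spec.1 ha h.choose_spec.2]

theorem image_form {f : Node → Node} (hf : Set.InjOn f α.nodes) {a : Node} (ha : a ∈ α.nodes) :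
    (α.image f).form (f a) = (α.form a).rename f := by
  have h : ∃ b ∈ α.nodes, f b = f a := ⟨a, ha, rfl⟩
  simp only [image, dif_pos h]
  rw [hf h.choose_spec.1 ha h.choose_spec.2]

theorem isoVia_image (hα : α.IsLPOF) {f : Node → Node} (hf : Set.InjOn f α.nodes) :
    IsoVia f α (α.image f) where
  bij := hf.bijOn_image
  lt_iff := fun x hx y hy => by
    refine ⟨?_, fun h => ⟨x, y, h, rfl, rfl⟩⟩
    rintro ⟨a, b, hab, ha, hb⟩
    rwa [← hf (hα.lt_mem _ _ hab).1 hx ha, ← hf (hα.lt_mem _ _ hab).2 hy hb]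
  label_eq := fun _ hx => image_label hf hx
  form_eq := fun _ hx => image_form hf hx

theorem IsLPOF.image (hα : α.IsLPOF) {f : Node → Node} (hf : Set.InjOn f α.nodes) :
    (α.image f).IsLPOF := by
  classical
  have hlt : ∀ y z, (α.image f).lt y z → ∃ a ∈ α.nodes, ∃ b ∈ α.nodes,
      α.lt a b ∧ f a = y ∧ f b = z := by
    rintro y z ⟨a, b, hab, ha, hb⟩
    exact ⟨a, (hα.lt_mem _ _ hab).1, b, (hα.lt_mem _ _ hab).2, hab, ha, hb⟩
  have hiff := (isoVia_image hα hf).lt_iff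
  have hmem : ∀ y z, (α.image f).lt y z → y ∈ f '' α.nodes ∧ z ∈ f '' α.nodes := by
    intro y z h
    obtain ⟨a, ha, b, hb, -, rfl, rfl⟩ := hlt y z h
    exact ⟨⟨a, ha, rfl⟩, ⟨b, hb, rfl⟩⟩
  have hbelow : ∀ a ∈ α.nodes, (α.image f).below (f a) = f '' α.below a := by
    intro a ha
    ext y
    constructor
    · intro hy
      obtain ⟨b, hb, c, hc, hbc, rfl, hca⟩ := hlt _ _ hy
      exact ⟨b, (hf hc ha hca) ▸ hbc, rfl⟩
    · rintro ⟨b, hb, rfl⟩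
      exact ⟨b, a, hb, rfl, rfl⟩
  have hirr : ∀ x, ¬ (α.image f).lt x x := by
    intro x h
    obtain ⟨a, ha, b, hb, hab, hax, hbx⟩ := hlt _ _ h
    rw [hf ha hb (hax.trans hbx.symm)] at hab
    exact hα.irrefl _ hab
  have htr : ∀ x y z, (α.image f).lt x y → (α.image f).lt y z → (α.image f).lt x z := by
    intro x y z h1 h2
    obtain ⟨a, ha, b, hb, hab, rfl, rfl⟩ := hlt _ _ h1
    obtain ⟨b', hb', c, hc, hbc, h3, rfl⟩ := hlt _ _ h2
    rw [hf hb' hb h3] at hbc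
    exact ⟨a, c, hα.trans _ _ _ hab hbc, rfl, rfl⟩
  have hfin : ∀ x ∈ (α.image f).nodes, ((α.image f).below x).Finite := by
    rintro _ ⟨a, ha, rfl⟩
    rw [hbelow a ha]
    exact (hα.finite_below a ha).image f
  have hsucc : ∀ a ∈ α.nodes, (α.image f).succ (f a) = f '' α.succ a := by
    intro a ha
    ext y
    constructor
    · rintro ⟨hy, hno⟩
      obtain ⟨a', ha', b, hb, hab, h1, rfl⟩ := hlt _ _ hy
      rw [hf ha' ha h1] at hab
      refine ⟨b, ⟨hab, ?_⟩, rfl⟩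
      rintro ⟨z, h2, h3⟩
      exact hno ⟨f z, ⟨a, z, h2, rfl, rfl⟩, ⟨z, b, h3, rfl, rfl⟩⟩
    · rintro ⟨b, ⟨hab, hno⟩, rfl⟩
      refine ⟨⟨a, b, hab, rfl, rfl⟩, ?_⟩
      rintro ⟨z, h2, h3⟩
      obtain ⟨_, -, c, hc, -, -, rfl⟩ := hlt _ _ h2
      exact hno ⟨c, (hiff a ha c hc).1 h2, (hiff c hc b (hα.lt_mem _ _ hab).2).1 h3⟩
  have hmins : (α.image f).mins = f '' α.mins := by
    have hsp : ∀ a ∈ α.nodes, ((α.image f).pred (f a) = ∅ ↔ α.pred a = ∅) := by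
      intro a ha
      simp only [Set.eq_empty_iff_forall_notMem]
      constructor
      · intro h y hy
        have hya := (hα.lt_mem _ _ hy.1).1
        refine h (f y) (?_ : f a ∈ (α.image f).succ (f y))
        rw [hsucc y hya]
        exact ⟨a, hy, rfl⟩
      · intro h y hy
        obtain ⟨b, hb, -, -, -, rfl, -⟩ := hlt _ _ hy.1
        have hy' : f a ∈ (α.image f).succ (f b) := hy
        rw [hsucc b hb] at hy'
        obtain ⟨c, hc, hca⟩ := hy'
        have := hf (hα.lt_mem _ _ hc.1).2 ha hca
        subst this
        exact h b hc
    ext y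
    constructor
    · rintro ⟨⟨a, ha, rfl⟩, hp⟩
      exact ⟨a, ⟨ha, (hsp a ha).1 hp⟩, rfl⟩
    · rintro ⟨a, ⟨ha, hp⟩, rfl⟩
      exact ⟨⟨a, ha, rfl⟩, (hsp a ha).2 hp⟩
  have hsuccmem : ∀ a b, b ∈ α.succ a → f b ∈ (α.image f).succ (f a) := by
    intro a b h
    rw [hsucc a (hα.lt_mem _ _ h.1).1]
    exact ⟨b, h, rfl⟩
  refine ⟨hmem, ?_, ?_, hα.countable.image f, hirr, htr, hfin, ?_, ?_, ?_, ?_, ?_, ?_⟩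
  · intro x hx
    have : ¬ ∃ a ∈ α.nodes, f a = x := fun ⟨a, ha, h⟩ => hx ⟨a, ha, h⟩
    simp only [PreLPOF.image, dif_neg this]
  · intro x hx
    have : ¬ ∃ a ∈ α.nodes, f a = x := fun ⟨a, ha, h⟩ => hx ⟨a, ha, h⟩
    simp only [PreLPOF.image, dif_neg this]
  · intro n
    refine ((hα.finite_level_le n).image f).subset ?_
    rintro _ ⟨⟨a, ha, rfl⟩, rfl⟩
    refine ⟨a, ⟨ha, lev_le_lev hirr htr (hfin _ ⟨a, ha, rfl⟩) ?_⟩, rfl⟩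
    rintro n ⟨c, h0, hn, hc⟩
    refine ⟨n, le_rfl, f ∘ c, ?_, by simp [hn], fun i hi => hsuccmem _ _ (hc i hi)⟩
    rw [hmins]
    exact ⟨c 0, h0, rfl⟩
  · obtain ⟨r, hr, hu⟩ := hα.single_root
    rw [hmins]
    refine ⟨f r, ⟨r, hr, rfl⟩, ?_⟩
    rintro _ ⟨a, ha, rfl⟩
    rw [hu a ha]
  · rintro _ ⟨a, ha, rfl⟩ h
    rw [image_label hf ha] at h
    rw [hsucc a ha, hα.bot_succ a ha h, Set.image_empty]
  · rintro _ ⟨a, ha, rfl⟩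
    rw [image_form hf ha]
    have : Nonempty Node := ⟨a⟩
    obtain ⟨v, hv⟩ := hα.form_sat a ha
    refine ⟨v ∘ Function.invFunOn f α.nodes, (Form.holds_rename _ _ _).2 ?_⟩
    refine (Form.holds_congr _ fun x hx => ?_).1 hv
    simp only [Function.comp]
    rw [hf.leftInvOn_invFunOn (hα.free_subset ha hx)]
  · rintro _ ⟨a, ha, rfl⟩
    rw [image_form hf ha, Form.free_rename, hbelow a ha]
    exact Set.image_mono (hα.form_free a ha)
  · intro x y h
    obtain ⟨a, ha, b, hb, hab, rfl, rfl⟩ := hlt _ _ h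
    rw [image_form hf ha, image_form hf hb]
    intro v hv
    rw [Form.holds_rename] at hv ⊢
    exact hα.form_entails a b hab _ hv

theorem isLPOF_single (x : Node) (ℓ : L) : (single x ℓ).IsLPOF where
  lt_mem := fun _ _ h => h.elim
  label_off := fun y hy => if_neg hy
  form_off := fun _ _ => rfl
  countable := Set.countable_singleton x
  irrefl := fun _ h => h
  trans := fun _ _ _ h _ => h
  finite_below := fun _ _ => Set.finite_empty.subset fun _ h => h
  finite_level := fun _ => (Set.finite_singleton x).subset fun _ h => h.1
  single_root := ⟨x, ⟨rfl, Set.eq_empty_of_forall_notMem fun _ h => h.1⟩, fun _ h => h.1⟩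
  bot_succ := fun _ _ _ => Set.eq_empty_of_forall_notMem fun _ h => h.1
  form_sat := fun _ _ => ⟨fun _ => true, trivial⟩
  form_free := fun _ _ _ h => h.elim
  form_entails := fun _ _ h => h.elim

theorem isLPOF_guard (hα : α.IsLPOF) (hβ : β.IsLPOF) {x : Node} {ℓ : L} (hℓ : ℓ ≠ ⊥)
    (hd : Disjoint α.nodes β.nodes) (hxα : x ∉ α.nodes) (hxβ : x ∉ β.nodes) :
    (guard x ℓ α β).IsLPOF := by
  classical
  have hdα : ∀ y ∈ α.nodes, y ∉ β.nodes := fun y h h' => Set.disjoint_left.1 hd h h'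
  have hdβ : ∀ y ∈ β.nodes, y ∉ α.nodes := fun y h h' => Set.disjoint_left.1 hd h' h
  have hneα : ∀ y ∈ α.nodes, y ≠ x := fun y h h' => hxα (h' ▸ h)
  have hneβ : ∀ y ∈ β.nodes, y ≠ x := fun y h h' => hxβ (h' ▸ h)
  have hnx : ∀ y, ¬ (guard x ℓ α β).lt y x := by
    rintro y (h | h | ⟨-, h | h⟩)
    · exact hxα (hα.lt_mem _ _ h).2
    · exact hxβ (hβ.lt_mem _ _ h).2
    · exact hxα h
    · exact hxβ h
  have hltα : ∀ y, ∀ z ∈ α.nodes, ((guard x ℓ α β).lt y z ↔ α.lt y z ∨ y = x) := by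
    intro y z hz
    refine ⟨?_, ?_⟩
    · rintro (h | h | ⟨h, -⟩)
      · exact Or.inl h
      · exact absurd (hβ.lt_mem _ _ h).2 (hdα z hz)
      · exact Or.inr h
    · rintro (h | h)
      · exact Or.inl h
      · exact Or.inr (Or.inr ⟨h, Or.inl hz⟩)
  have hltβ : ∀ y, ∀ z ∈ β.nodes, ((guard x ℓ α β).lt y z ↔ β.lt y z ∨ y = x) := by
    intro y z hz
    refine ⟨?_, ?_⟩
    · rintro (h | h | ⟨h, -⟩)
      · exact absurd (hα.lt_mem _ _ h).2 (hdβ z hz)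
      · exact Or.inl h
      · exact Or.inr h
    · rintro (h | h)
      · exact Or.inr (Or.inl h)
      · exact Or.inr (Or.inr ⟨h, Or.inr hz⟩)
  have hcase : ∀ y ∈ (guard x ℓ α β).nodes, y = x ∨ y ∈ α.nodes ∨ y ∈ β.nodes := by
    rintro y ((h | h) | h)
    exacts [Or.inl h, Or.inr (Or.inl h), Or.inr (Or.inr h)]
  have hmem : ∀ y z, (guard x ℓ α β).lt y z →
      y ∈ (guard x ℓ α β).nodes ∧ (z ∈ α.nodes ∨ z ∈ β.nodes) := by
    rintro y z (h | h | ⟨h, h'⟩)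
    · exact ⟨Or.inl (Or.inr (hα.lt_mem _ _ h).1), Or.inl (hα.lt_mem _ _ h).2⟩
    · exact ⟨Or.inr (hβ.lt_mem _ _ h).1, Or.inr (hβ.lt_mem _ _ h).2⟩
    · exact ⟨Or.inl (Or.inl h), h'⟩
  have hirr : ∀ y, ¬ (guard x ℓ α β).lt y y := by
    intro y h
    rcases (hmem _ _ h).2 with hy | hy
    · exact ((hltα y y hy).1 h).elim (hα.irrefl y) (hneα y hy)
    · exact ((hltβ y y hy).1 h).elim (hβ.irrefl y) (hneβ y hy)
  have htr : ∀ a b c, (guard x ℓ α β).lt a b → (guard x ℓ α β).lt b c →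
      (guard x ℓ α β).lt a c := by
    intro a b c h1 h2
    rcases (hmem _ _ h2).2 with hc | hc
    · rcases (hltα b c hc).1 h2 with h3 | rfl
      · rw [hltα _ _ hc]
        rcases (hltα a b (hα.lt_mem _ _ h3).1).1 h1 with h4 | h4
        · exact Or.inl (hα.trans _ _ _ h4 h3)
        · exact Or.inr h4
      · exact absurd h1 (hnx a)
    · rcases (hltβ b c hc).1 h2 with h3 | rfl
      · rw [hltβ _ _ hc]
        rcases (hltβ a b (hβ.lt_mem _ _ h3).1).1 h1 with h4 | h4
        · exact Or.inl (hβ.trans _ _ _ h4 h3)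
        · exact Or.inr h4
      · exact absurd h1 (hnx a)
  have hbelowα : ∀ y ∈ α.nodes, (guard x ℓ α β).below y = insert x (α.below y) := by
    intro y hy
    ext z
    exact (hltα z y hy).trans or_comm
  have hbelowβ : ∀ y ∈ β.nodes, (guard x ℓ α β).below y = insert x (β.below y) := by
    intro y hy
    ext z
    exact (hltβ z y hy).trans or_comm
  have hfin : ∀ y ∈ (guard x ℓ α β).nodes, ((guard x ℓ α β).below y).Finite := by
    intro y hy
    rcases hcase y hy with rfl | hy | hy
    · exact Set.finite_empty.subset fun z hz => hnx z hz
    · rw [hbelowα y hy]; exact (hα.finite_below y hy).insert x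
    · rw [hbelowβ y hy]; exact (hβ.finite_below y hy).insert x
  have hsuccα : ∀ y ∈ α.nodes, (guard x ℓ α β).succ y = α.succ y := by
    intro y hy
    have hup : ∀ z, (guard x ℓ α β).lt y z ↔ α.lt y z := by
      intro z
      refine ⟨?_, Or.inl⟩
      rintro (h | h | ⟨h, -⟩)
      · exact h
      · exact absurd (hβ.lt_mem _ _ h).1 (hdα y hy)
      · exact absurd h (hneα y hy)
    ext z
    refine and_congr (hup z) (not_congr (exists_congr fun w => ?_))
    rw [hup w]
    refine and_congr_right fun hw => ?_
    refine ⟨?_, Or.inl⟩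
    rintro (h | h | ⟨h, -⟩)
    · exact h
    · exact absurd (hβ.lt_mem _ _ h).1 (hdα w (hα.lt_mem _ _ hw).2)
    · exact absurd h (hneα w (hα.lt_mem _ _ hw).2)
  have hsuccβ : ∀ y ∈ β.nodes, (guard x ℓ α β).succ y = β.succ y := by
    intro y hy
    have hup : ∀ z, (guard x ℓ α β).lt y z ↔ β.lt y z := by
      intro z
      refine ⟨?_, fun h => Or.inr (Or.inl h)⟩
      rintro (h | h | ⟨h, -⟩)
      · exact absurd (hα.lt_mem _ _ h).1 (hdβ y hy)
      · exact h
      · exact absurd h (hneβ y hy)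
    ext z
    refine and_congr (hup z) (not_congr (exists_congr fun w => ?_))
    rw [hup w]
    refine and_congr_right fun hw => ?_
    refine ⟨?_, fun h => Or.inr (Or.inl h)⟩
    rintro (h | h | ⟨h, -⟩)
    · exact absurd (hα.lt_mem _ _ h).1 (hdβ w (hβ.lt_mem _ _ hw).2)
    · exact h
    · exact absurd h (hneβ w (hβ.lt_mem _ _ hw).2)
  have hsuccx : ∀ y, (y ∈ α.mins ∨ y ∈ β.mins) → y ∈ (guard x ℓ α β).succ x := by
    rintro y (hy | hy)
    · rw [hα.mem_mins_iff] at hy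
      refine ⟨Or.inr (Or.inr ⟨rfl, Or.inl hy.1⟩), ?_⟩
      rintro ⟨z, h1, h2⟩
      rcases (hltα z y hy.1).1 h2 with h3 | rfl
      · exact hy.2 z h3
      · exact hnx _ h1
    · rw [hβ.mem_mins_iff] at hy
      refine ⟨Or.inr (Or.inr ⟨rfl, Or.inr hy.1⟩), ?_⟩
      rintro ⟨z, h1, h2⟩
      rcases (hltβ z y hy.1).1 h2 with h3 | rfl
      · exact hy.2 z h3
      · exact hnx _ h1
  have hxmin : x ∈ (guard x ℓ α β).mins :=
    ⟨Or.inl (Or.inl rfl), Set.eq_empty_of_forall_notMem fun z hz => hnx z hz.1⟩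
  have hpath : ∀ δ : PreLPOF Node L, δ.IsLPOF → (∀ y ∈ δ.mins, y ∈ (guard x ℓ α β).succ x) →
      (∀ y ∈ δ.nodes, (guard x ℓ α β).succ y = δ.succ y) →
      ∀ y n, δ.PathTo y n → (guard x ℓ α β).PathTo y (n + 1) := by
    rintro δ hδ h1 h2 y n ⟨c, h0, hn, hc⟩
    refine ⟨fun i => if i = 0 then x else c (i - 1), by simpa using hxmin, by simpa using hn, ?_⟩
    intro i hi
    rcases Nat.eq_zero_or_pos i with rfl | hpos
    · simpa using h1 _ h0
    · obtain ⟨j, rfl⟩ : ∃ j, i = j + 1 := ⟨i - 1, by omega⟩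
      have h3 := hc j (by omega)
      have h4 : (guard x ℓ α β).succ (c j) = δ.succ (c j) := h2 _ (hδ.lt_mem _ _ h3.1).1
      simp only [Nat.add_sub_cancel, Nat.add_eq_zero_iff, one_ne_zero, and_false, if_false]
      rw [h4]
      exact h3
  have hlabx : (guard x ℓ α β).label x = ℓ := if_pos rfl
  have hlabα : ∀ y ∈ α.nodes, (guard x ℓ α β).label y = α.label y := fun y hy => by
    simp only [PreLPOF.guard, if_neg (hneα y hy), if_pos hy]
  have hlabβ : ∀ y ∈ β.nodes, (guard x ℓ α β).label y = β.label y := fun y hy => by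
    simp only [PreLPOF.guard, if_neg (hneβ y hy), if_neg (hdβ y hy), if_pos hy]
  have hfx : (guard x ℓ α β).form x = Form.tt := if_pos rfl
  have hfα : ∀ y ∈ α.nodes,
      (guard x ℓ α β).form y = Form.conj (α.form y) (Form.var x) := fun y hy => by
    simp only [PreLPOF.guard, if_neg (hneα y hy), if_pos hy]
  have hfβ : ∀ y ∈ β.nodes,
      (guard x ℓ α β).form y = Form.conj (β.form y) (Form.neg (Form.var x)) := fun y hy => by
    simp only [PreLPOF.guard, if_neg (hneβ y hy), if_neg (hdβ y hy), if_pos hy]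
  refine ⟨?_, ?_, ?_, ?_, hirr, htr, hfin, ?_, ?_, ?_, ?_, ?_, ?_⟩
  · intro y z h
    refine ⟨(hmem y z h).1, ?_⟩
    rcases (hmem y z h).2 with h | h
    · exact Or.inl (Or.inr h)
    · exact Or.inr h
  · intro y hy
    simp only [PreLPOF.guard, Set.mem_union, Set.mem_singleton_iff, not_or] at hy
    simp only [PreLPOF.guard, if_neg hy.1.1, if_neg hy.1.2, if_neg hy.2]
  · intro y hy
    simp only [PreLPOF.guard, Set.mem_union, Set.mem_singleton_iff, not_or] at hy
    simp only [PreLPOF.guard, if_neg hy.1.1, if_neg hy.1.2, if_neg hy.2]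
  · exact ((Set.countable_singleton x).union hα.countable).union hβ.countable
  · intro n
    refine (((Set.finite_singleton x).union (hα.finite_level_le n)).union
      (hβ.finite_level_le n)).subset ?_
    rintro y ⟨hy, rfl⟩
    have hyf := hfin y hy
    rcases hcase y hy with h | h | h
    · exact Or.inl (Or.inl h)
    · refine Or.inl (Or.inr ⟨h, lev_le_lev hirr htr hyf fun n hn => ⟨n + 1, by omega, ?_⟩⟩)
      exact hpath α hα (fun z hz => hsuccx z (Or.inl hz)) hsuccα y n hn
    · refine Or.inr ⟨h, lev_le_lev hirr htr hyf fun n hn => ⟨n + 1, by omega, ?_⟩⟩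
      exact hpath β hβ (fun z hz => hsuccx z (Or.inr hz)) hsuccβ y n hn
  · refine ⟨x, hxmin, fun y hy => ?_⟩
    have key : ∀ δ : PreLPOF Node L, δ.IsLPOF → (∀ z ∈ δ.mins, z ∈ (guard x ℓ α β).succ x) →
        (∀ z ∈ δ.nodes, (guard x ℓ α β).succ z = δ.succ z) → y ∉ δ.nodes := by
      intro δ hδ h1 h2 hyδ
      have hyp := hy.2
      rw [Set.eq_empty_iff_forall_notMem] at hyp
      by_cases hm : y ∈ δ.mins
      · exact hyp x (h1 y hm)
      · rw [hδ.mem_mins_iff] at hm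
        push Not at hm
        obtain ⟨z, hz⟩ := hm hyδ
        obtain ⟨w, hw⟩ := hδ.exists_pred hz
        refine hyp w (?_ : y ∈ (guard x ℓ α β).succ w)
        rw [h2 w (hδ.lt_mem _ _ hw.1).1]
        exact hw
    rcases hcase y hy.1 with h | h | h
    · exact h
    · exact absurd h (key α hα (fun z hz => hsuccx z (Or.inl hz)) hsuccα)
    · exact absurd h (key β hβ (fun z hz => hsuccx z (Or.inr hz)) hsuccβ)
  · intro y hy hb
    rcases hcase y hy with rfl | h | h
    · exact absurd (hlabx ▸ hb) hℓ
    · rw [hsuccα y h]; exact hα.bot_succ y h (hlabα y h ▸ hb)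
    · rw [hsuccβ y h]; exact hβ.bot_succ y h (hlabβ y h ▸ hb)
  · intro y hy
    rcases hcase y hy with rfl | h | h
    · rw [hfx]; exact ⟨fun _ => true, trivial⟩
    · rw [hfα y h]
      obtain ⟨v, hv⟩ := hα.form_sat y h
      refine ⟨Function.update v x true, (Form.holds_congr _ fun z hz => ?_).1 hv, ?_⟩
      · rw [Function.update_of_ne (hneα z (hα.free_subset h hz))]
      · simp [Form.Holds]
    · rw [hfβ y h]
      obtain ⟨v, hv⟩ := hβ.form_sat y h
      refine ⟨Function.update v x false, (Form.holds_congr _ fun z hz => ?_).1 hv, ?_⟩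
      · rw [Function.update_of_ne (hneβ z (hβ.free_subset h hz))]
      · simp [Form.Holds]
  · intro y hy
    rcases hcase y hy with rfl | h | h
    · rw [hfx]; exact Set.empty_subset _
    · rw [hfα y h, hbelowα y h]
      rintro z (hz | hz)
      · exact Or.inr (hα.form_free y h hz)
      · exact Or.inl hz
    · rw [hfβ y h, hbelowβ y h]
      rintro z (hz | hz)
      · exact Or.inr (hβ.form_free y h hz)
      · exact Or.inl hz
  · intro y z h v hv
    rcases (hmem y z h).2 with hz | hz
    · rw [hfα z hz] at hv
      rcases (hltα y z hz).1 h with h' | rfl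
      · rw [hfα y (hα.lt_mem _ _ h').1]
        exact ⟨hα.form_entails y z h' v hv.1, hv.2⟩
      · rw [hfx]; trivial
    · rw [hfβ z hz] at hv
      rcases (hltβ y z hz).1 h with h' | rfl
      · rw [hfβ y (hβ.lt_mem _ _ h').1]
        exact ⟨hβ.form_entails y z h' v hv.1, hv.2⟩
      · rw [hfx]; trivial

/-- Guarded choice respects isomorphism. -/
theorem isoVia_guard {α' β' : PreLPOF Node L} (hα : α.IsLPOF) (hβ : β.IsLPOF) (hα' : α'.IsLPOF)
    (hβ' : β'.IsLPOF) {f g : Node → Node} (hf : IsoVia f α α') (hg : IsoVia g β β')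
    {x x' : Node} {ℓ : L}
    (hd : Disjoint α.nodes β.nodes) (hxα : x ∉ α.nodes) (hxβ : x ∉ β.nodes)
    (hd' : Disjoint α'.nodes β'.nodes) (hxα' : x' ∉ α'.nodes) (hxβ' : x' ∉ β'.nodes) :
    ∃ h, IsoVia h (guard x ℓ α β) (guard x' ℓ α' β') := by
  classical
  let h : Node → Node := fun y => if y = x then x' else if y ∈ α.nodes then f y else g y
  have hx : h x = x' := if_pos rfl
  have hneα : ∀ y ∈ α.nodes, y ≠ x := fun y h h' => hxα (h' ▸ h)
  have hneβ : ∀ y ∈ β.nodes, y ≠ x := fun y h h' => hxβ (h' ▸ h)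
  have hneα' : ∀ y ∈ α'.nodes, y ≠ x' := fun y h h' => hxα' (h' ▸ h)
  have hneβ' : ∀ y ∈ β'.nodes, y ≠ x' := fun y h h' => hxβ' (h' ▸ h)
  have hdβ : ∀ y ∈ β.nodes, y ∉ α.nodes := fun y h h' => Set.disjoint_left.1 hd h' h
  have hdβ' : ∀ y ∈ β'.nodes, y ∉ α'.nodes := fun y h h' => Set.disjoint_left.1 hd' h' h
  have ha : ∀ y ∈ α.nodes, h y = f y := fun y hy => by simp [h, hneα y hy, hy]
  have hb : ∀ y ∈ β.nodes, h y = g y := fun y hy => by simp [h, hneβ y hy, hdβ y hy]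
  have haM : ∀ y ∈ α.nodes, h y ∈ α'.nodes := fun y hy => ha y hy ▸ hf.bij.mapsTo hy
  have hbM : ∀ y ∈ β.nodes, h y ∈ β'.nodes := fun y hy => hb y hy ▸ hg.bij.mapsTo hy
  have hltα : ∀ y ∈ α.nodes, ∀ z ∈ α.nodes, (α'.lt (h y) (h z) ↔ α.lt y z) :=
    fun y hy z hz => by rw [ha y hy, ha z hz, hf.lt_iff y hy z hz]
  have hltβ : ∀ y ∈ β.nodes, ∀ z ∈ β.nodes, (β'.lt (h y) (h z) ↔ β.lt y z) :=
    fun y hy z hz => by rw [hb y hy, hb z hz, hg.lt_iff y hy z hz]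
  have hcase : ∀ y ∈ (PreLPOF.guard x ℓ α β).nodes, y = x ∨ y ∈ α.nodes ∨ y ∈ β.nodes := by
    rintro y ((h | h) | h)
    exacts [Or.inl h, Or.inr (Or.inl h), Or.inr (Or.inr h)]
  have mA : ∀ y ∈ (PreLPOF.guard x ℓ α β).nodes, (h y ∈ α'.nodes ↔ y ∈ α.nodes) := by
    intro y hy
    refine ⟨fun hh => ?_, haM y⟩
    rcases hcase y hy with rfl | hy | hy
    · exact absurd (hx ▸ hh) hxα'
    · exact hy
    · exact absurd hh (hdβ' _ (hbM y hy))
  have mB : ∀ y ∈ (PreLPOF.guard x ℓ α β).nodes, (h y ∈ β'.nodes ↔ y ∈ β.nodes) := by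
    intro y hy
    refine ⟨fun hh => ?_, hbM y⟩
    rcases hcase y hy with rfl | hy | hy
    · exact absurd (hx ▸ hh) hxβ'
    · exact absurd (haM y hy) (hdβ' _ hh)
    · exact hy
  have mX : ∀ y ∈ (PreLPOF.guard x ℓ α β).nodes, (h y = x' ↔ y = x) := by
    intro y hy
    refine ⟨fun hh => ?_, fun hh => hh ▸ hx⟩
    rcases hcase y hy with rfl | hy | hy
    · rfl
    · exact absurd hh (hneα' _ (haM y hy))
    · exact absurd hh (hneβ' _ (hbM y hy))
  refine ⟨h, ⟨?_, ?_, ?_⟩, ?_, ?_, ?_⟩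
  · intro y hy
    rcases hcase y hy with rfl | hy | hy
    · exact Or.inl (Or.inl hx)
    · exact Or.inl (Or.inr (haM y hy))
    · exact Or.inr (hbM y hy)
  · intro y hy z hz hyz
    rcases hcase y hy with rfl | hy' | hy'
    · exact ((mX z hz).1 (hyz ▸ hx)).symm
    · have hz' := (mA z hz).1 (hyz ▸ haM y hy')
      rw [ha y hy', ha z hz'] at hyz
      exact hf.bij.injOn hy' hz' hyz
    · have hz' := (mB z hz).1 (hyz ▸ hbM y hy')
      rw [hb y hy', hb z hz'] at hyz
      exact hg.bij.injOn hy' hz' hyz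
  · rintro y ((hy | hy) | hy)
    · exact ⟨x, Or.inl (Or.inl rfl), hx.trans hy.symm⟩
    · obtain ⟨z, hz, rfl⟩ := hf.bij.surjOn hy
      exact ⟨z, Or.inl (Or.inr hz), ha z hz⟩
    · obtain ⟨z, hz, rfl⟩ := hg.bij.surjOn hy
      exact ⟨z, Or.inr hz, hb z hz⟩
  · intro y hy z hz
    refine or_congr ⟨fun hh => ?_, fun hh => ?_⟩ (or_congr ⟨fun hh => ?_, fun hh => ?_⟩
      (and_congr (mX y hy) (or_congr (mA z hz) (mB z hz))))
    · have := hα'.lt_mem _ _ hh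
      exact (hltα y ((mA y hy).1 this.1) z ((mA z hz).1 this.2)).1 hh
    · exact (hltα y (hα.lt_mem _ _ hh).1 z (hα.lt_mem _ _ hh).2).2 hh
    · have := hβ'.lt_mem _ _ hh
      exact (hltβ y ((mB y hy).1 this.1) z ((mB z hz).1 this.2)).1 hh
    · exact (hltβ y (hβ.lt_mem _ _ hh).1 z (hβ.lt_mem _ _ hh).2).2 hh
  · intro y hy
    simp only [PreLPOF.guard, mX y hy, mA y hy, mB y hy]
    split_ifs with h1 h2 h3
    · rfl
    · rw [ha y h2, hf.label_eq y h2]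
    · rw [hb y h3, hg.label_eq y h3]
    · rfl
  · intro y hy
    simp only [PreLPOF.guard, mX y hy, mA y hy, mB y hy]
    split_ifs with h1 h2 h3
    · rfl
    · simp only [Form.rename, hx]
      rw [ha y h2, hf.form_eq y h2]
      rw [Form.rename_congr _ fun z hz => (ha z (hα.free_subset h2 hz)).symm]
    · simp only [Form.rename, hx]
      rw [hb y h3, hg.form_eq y h3]
      rw [Form.rename_congr _ fun z hz => (hb z (hβ.free_subset h3 hz)).symm]
    · rfl

/-- Everything isomorphic to a guarded choice is a guarded choice. -/
theorem IsoVia.eq_guard (hα : α.IsLPOF) (hβ : β.IsLPOF) (hγ : γ.IsLPOF) {x : Node} {ℓ : L}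
    (hℓ : ℓ ≠ ⊥) (hd : Disjoint α.nodes β.nodes) (hxα : x ∉ α.nodes) (hxβ : x ∉ β.nodes)
    {f : Node → Node} (h : IsoVia f (PreLPOF.guard x ℓ α β) γ) :
    Set.InjOn f α.nodes ∧ Set.InjOn f β.nodes ∧
      Disjoint (α.image f).nodes (β.image f).nodes ∧ f x ∉ (α.image f).nodes ∧
      f x ∉ (β.image f).nodes ∧ γ = PreLPOF.guard (f x) ℓ (α.image f) (β.image f) := by
  classical
  have hinj := h.bij.injOn
  have sα : α.nodes ⊆ (PreLPOF.guard x ℓ α β).nodes := fun y hy => Or.inl (Or.inr hy)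
  have sβ : β.nodes ⊆ (PreLPOF.guard x ℓ α β).nodes := fun y hy => Or.inr hy
  have sx : x ∈ (PreLPOF.guard x ℓ α β).nodes := Or.inl (Or.inl rfl)
  have iα := hinj.mono sα
  have iβ := hinj.mono sβ
  have d' : Disjoint (α.image f).nodes (β.image f).nodes := by
    rw [Set.disjoint_left]
    rintro _ ⟨a, ha, rfl⟩ ⟨b, hb, hab⟩
    rw [hinj (sβ hb) (sα ha) hab] at hb
    exact Set.disjoint_left.1 hd ha hb
  have x1 : f x ∉ (α.image f).nodes := by
    rintro ⟨a, ha, hax⟩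
    exact hxα (hinj (sα ha) sx hax ▸ ha)
  have x2 : f x ∉ (β.image f).nodes := by
    rintro ⟨a, ha, hax⟩
    exact hxβ (hinj (sβ ha) sx hax ▸ ha)
  refine ⟨iα, iβ, d', x1, x2, ?_⟩
  have hG := isLPOF_guard hα hβ hℓ hd hxα hxβ
  have hα' := hα.image iα
  have hβ' := hβ.image iβ
  have hG' := isLPOF_guard hα' hβ' hℓ d' x1 x2
  have hIα := isoVia_image hα iα
  have hIβ := isoVia_image hβ iβ
  have hn : γ.nodes = (PreLPOF.guard (f x) ℓ (α.image f) (β.image f)).nodes := by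
    rw [← h.bij.image_eq]
    simp only [PreLPOF.guard, PreLPOF.image, Set.image_union, Set.image_singleton]
  have hneα : ∀ y ∈ α.nodes, y ≠ x := fun y h h' => hxα (h' ▸ h)
  have hneβ : ∀ y ∈ β.nodes, y ≠ x := fun y h h' => hxβ (h' ▸ h)
  have hdβ : ∀ y ∈ β.nodes, y ∉ α.nodes := fun y h h' => Set.disjoint_left.1 hd h' h
  have mα : ∀ a ∈ α.nodes, f a ∈ (α.image f).nodes := fun a ha => ⟨a, ha, rfl⟩
  have mβ : ∀ a ∈ β.nodes, f a ∈ (β.image f).nodes := fun a ha => ⟨a, ha, rfl⟩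
  have nα : ∀ a ∈ α.nodes, f a ≠ f x := fun a ha e => x1 (e ▸ mα a ha)
  have nβ : ∀ a ∈ β.nodes, f a ≠ f x := fun a ha e => x2 (e ▸ mβ a ha)
  have dβ : ∀ a ∈ β.nodes, f a ∉ (α.image f).nodes :=
    fun a ha e => Set.disjoint_left.1 d' e (mβ a ha)
  ext y z
  · rw [hn]
  · constructor
    · intro hyz
      obtain ⟨a, ha, rfl⟩ := h.bij.surjOn (hγ.lt_mem _ _ hyz).1
      obtain ⟨b, hb, rfl⟩ := h.bij.surjOn (hγ.lt_mem _ _ hyz).2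
      rcases (h.lt_iff a ha b hb).1 hyz with hh | hh | ⟨rfl, hh | hh⟩
      · exact Or.inl ⟨a, b, hh, rfl, rfl⟩
      · exact Or.inr (Or.inl ⟨a, b, hh, rfl, rfl⟩)
      · exact Or.inr (Or.inr ⟨rfl, Or.inl (mα b hh)⟩)
      · exact Or.inr (Or.inr ⟨rfl, Or.inr (mβ b hh)⟩)
    · rintro (⟨a, b, hab, rfl, rfl⟩ | ⟨a, b, hab, rfl, rfl⟩ | ⟨rfl, ⟨b, hb, rfl⟩ | ⟨b, hb, rfl⟩⟩)
      · exact (h.lt_iff a (sα (hα.lt_mem _ _ hab).1) b (sα (hα.lt_mem _ _ hab).2)).2 (Or.inl hab)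
      · exact (h.lt_iff a (sβ (hβ.lt_mem _ _ hab).1) b (sβ (hβ.lt_mem _ _ hab).2)).2
          (Or.inr (Or.inl hab))
      · exact (h.lt_iff x sx b (sα hb)).2 (Or.inr (Or.inr ⟨rfl, Or.inl hb⟩))
      · exact (h.lt_iff x sx b (sβ hb)).2 (Or.inr (Or.inr ⟨rfl, Or.inr hb⟩))
  · by_cases hy : y ∈ γ.nodes
    · obtain ⟨a, ha, rfl⟩ := h.bij.surjOn hy
      rw [h.label_eq a ha]
      rcases ha with (ha | ha) | ha
      · rw [Set.mem_singleton_iff] at ha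
        subst ha
        simp only [PreLPOF.guard, if_true]
      · simp only [PreLPOF.guard, if_neg (hneα a ha), if_pos ha, if_neg (nα a ha), if_pos (mα a ha),
          hIα.label_eq a ha]
      · simp only [PreLPOF.guard, if_neg (hneβ a ha), if_pos ha, if_neg (nβ a ha), if_pos (mβ a ha),
          if_neg (hdβ a ha), if_neg (dβ a ha), hIβ.label_eq a ha]
    · rw [hγ.label_off y hy, hG'.label_off y (hn ▸ hy)]
  · by_cases hy : y ∈ γ.nodes
    · obtain ⟨a, ha, rfl⟩ := h.bij.surjOn hy
      rw [h.form_eq a ha]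
      rcases ha with (ha | ha) | ha
      · rw [Set.mem_singleton_iff] at ha
        subst ha
        simp only [PreLPOF.guard, if_true, Form.rename]
      · simp only [PreLPOF.guard, if_neg (hneα a ha), if_pos ha, if_neg (nα a ha), if_pos (mα a ha),
          hIα.form_eq a ha, Form.rename]
      · simp only [PreLPOF.guard, if_neg (hneβ a ha), if_pos ha, if_neg (nβ a ha), if_pos (mβ a ha),
          if_neg (hdβ a ha), if_neg (dβ a ha), hIβ.form_eq a ha, Form.rename]
    · rw [hγ.form_off y hy, hG'.form_off y (hn ▸ hy)]

/-- If `β` is isomorphic to a structure that is at most `α` and `α` is at most `β`, then the two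
structures are equal. -/
theorem IsoVia.eq_of_le {β' : PreLPOF Node L} (hα : α.IsLPOF) (hβ : β.IsLPOF) (hβ' : β'.IsLPOF)
    {f : Node → Node} (h : IsoVia f β β') (h1 : β'.Le α) (h2 : α.Le β) : α = β := by
  have hle := Le.trans hβ' hα hβ h1 h2
  have hsub : ∀ x ∈ β.nodes, f x ∈ β'.nodes := fun x hx => h.bij.mapsTo hx
  have hb' : ∀ y ∈ β'.nodes, β'.below y = β.below y := by
    intro y hy
    ext z
    exact ⟨fun hz => ((hle.lt_iff z y).1 hz).1,
      fun hz => (hle.lt_iff z y).2 ⟨hz, hle.down y hy hz, hy⟩⟩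
  have hcard : ∀ x ∈ β.nodes, (β.below (f x)).ncard = (β.below x).ncard := by
    intro x hx
    have himg : f '' β.below x = β'.below (f x) := by
      ext z
      constructor
      · rintro ⟨y, hy, rfl⟩
        exact (h.lt_iff y (hβ.lt_mem _ _ hy).1 x hx).2 hy
      · intro hz
        obtain ⟨y, hy, rfl⟩ := h.bij.surjOn (hβ'.lt_mem _ _ hz).1
        exact ⟨y, (h.lt_iff y hy x hx).1 hz, rfl⟩
    rw [← hb' _ (hsub x hx), ← himg]
    exact (h.bij.injOn.mono fun y hy => (hβ.lt_mem _ _ hy).1).ncard_image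
  let P : ℕ → Set Node := fun k => {x | x ∈ β.nodes ∧ (β.below x).ncard = k}
  have hPfin : ∀ k, (P k).Finite := fun k => by
    refine (hβ.finite_level_le k).subset ?_
    rintro x ⟨hx, rfl⟩
    exact ⟨hx, lev_le_ncard hβ.irrefl hβ.trans (hβ.finite_below x hx)⟩
  have hPmaps : ∀ k, Set.MapsTo f (P k) (P k) := fun k x hx =>
    ⟨hle.subset (hsub x hx.1), (hcard x hx.1).trans hx.2⟩
  have hPinj : ∀ k, Set.InjOn f (P k) := fun k => h.bij.injOn.mono fun x hx => hx.1
  have hPsurj : ∀ k, Set.SurjOn f (P k) (P k) := fun k =>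
    ((hPfin k).surjOn_iff_bijOn_of_mapsTo (hPmaps k)).2
      (((hPfin k).injOn_iff_bijOn_of_mapsTo (hPmaps k)).1 (hPinj k))
  have hn : β.nodes ⊆ β'.nodes := by
    intro x hx
    obtain ⟨y, hy, rfl⟩ := hPsurj _ (⟨hx, rfl⟩ : x ∈ P _)
    exact hsub y hy.1
  have hlab : ∀ x ∈ β.nodes, β.label x ≤ α.label (f x) := fun x hx => by
    rw [← h.label_eq x hx]; exact h1.label_le _ (hsub x hx)
  have hlab2 : ∀ x ∈ β.nodes, β.label x ≤ β.label (f x) := fun x hx =>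
    (hlab x hx).trans (h2.label_le _ (h1.subset (hsub x hx)))
  have hiter : ∀ x ∈ β.nodes, β.label (f x) ≤ β.label x := by
    intro x hx
    have hmaps : ∀ n, f^[n] x ∈ P (β.below x).ncard := fun n =>
      (hPmaps _).iterate n (⟨hx, rfl⟩ : x ∈ P _)
    have hmono : ∀ n y, y ∈ P (β.below x).ncard → β.label y ≤ β.label (f^[n] y) := by
      intro n
      induction n with
      | zero => intro y _; exact le_rfl
      | succ n ih =>
        intro y hy
        rw [Function.iterate_succ_apply]
        exact (hlab2 y hy.1).trans (ih _ (hPmaps _ hy))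
    obtain ⟨m, n, hmn, he⟩ : ∃ m n, m < n ∧ f^[m] x = f^[n] x := by
      by_contra! hne
      have : Function.Injective fun n => f^[n] x := by
        intro m n he
        rcases lt_trichotomy m n with h' | h' | h'
        · exact absurd he (hne m n h')
        · exact h'
        · exact absurd he.symm (hne n m h')
      exact Set.infinite_range_of_injective this
        ((hPfin _).subset (by rintro _ ⟨n, rfl⟩; exact hmaps n))
    have hcancel : ∀ m, ∀ y ∈ P (β.below x).ncard, ∀ z ∈ P (β.below x).ncard,
        f^[m] y = f^[m] z → y = z := fun m y hy z hz e =>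
      ((hPinj _).iterate (hPmaps _) m) hy hz e
    obtain ⟨k, rfl⟩ : ∃ k, n = m + (k + 1) := ⟨n - m - 1, by omega⟩
    rw [Function.iterate_add_apply] at he
    have hper : x = f^[k + 1] x := hcancel m x ⟨hx, rfl⟩ _ (hmaps (k + 1)) he
    calc β.label (f x) ≤ β.label (f^[k] (f x)) := hmono k _ (hmaps 1)
      _ = β.label x := by rw [← Function.iterate_succ_apply, ← hper]
  have hnα : α.nodes = β.nodes := h2.subset.antisymm (hn.trans h1.subset)
  refine Le.antisymm hα hβ h2 ?_
  refine ⟨hnα.ge, fun _ _ z hz => hnα ▸ (hα.lt_mem _ _ hz).1, fun x y => ?_, fun x hx => ?_,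
    fun x hx => (h2.form_eq x (hnα ▸ hx)).symm, fun x hx => ?_⟩
  · rw [h2.lt_iff, hnα]
    exact ⟨fun hh => ⟨⟨hh, hβ.lt_mem _ _ hh⟩, hβ.lt_mem _ _ hh⟩, fun hh => hh.1.1⟩
  · obtain ⟨y, hy, rfl⟩ := hPsurj _ (⟨hx, rfl⟩ : x ∈ P _)
    exact (hiter y hy.1).trans (hlab y hy.1)
  · have e1 : β.succ x = α.succ x := by
      have : ∀ a b, α.lt a b ↔ β.lt a b := fun a b => by
        rw [h2.lt_iff, hnα]
        exact ⟨fun hh => hh.1, fun hh => ⟨hh, hβ.lt_mem _ _ hh⟩⟩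
      ext y
      simp only [PreLPOF.succ, PreLPOF.above, Set.mem_ofPred_eq, this]
    rw [e1]
    symm
    rw [sdiff_eq_left, Set.disjoint_left]
    intro y hy hy'
    simp only [aboveSet, Set.mem_iUnion] at hy'
    obtain ⟨b, hb, hby⟩ := hy'
    have hbβ : β.lt b y := ((h2.lt_iff b y).1 hby).1
    have : y ∈ β.aboveSet β.bots := by
      simp only [aboveSet, Set.mem_iUnion]; exact ⟨b, hb, hbβ⟩
    rw [← Le.aboveSet_eq hβ hβ (Le.refl hβ)] at this
    exact this.2 this.1

end facts

end PreLPOF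

/-- Labelled partial orders with formulae. -/
@[ext]
structure LPOF (Node : Type u) (L : Type v) [PartialOrder L] [OrderBot L]
    extends PreLPOF Node L where
  isLPOF : toPreLPOF.IsLPOF

namespace LPOF

variable {Node : Type u} {L : Type v} [PartialOrder L] [OrderBot L]

instance : PartialOrder (LPOF Node L) where
  le α β := α.toPreLPOF.Le β.toPreLPOF
  le_refl α := PreLPOF.Le.refl α.isLPOF
  le_trans α β γ h h' := PreLPOF.Le.trans α.isLPOF β.isLPOF γ.isLPOF h h'
  le_antisymm α β h h' := by
    have := PreLPOF.Le.antisymm α.isLPOF β.isLPOF h h'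
    cases α; cases β; cases this; rfl

/-- Isomorphism `α ≡ β`. -/
def Iso (α β : LPOF Node L) : Prop :=
  ∃ f : Node → Node, PreLPOF.IsoVia f α.toPreLPOF β.toPreLPOF

theorem Iso.refl (α : LPOF Node L) : Iso α α := ⟨_, PreLPOF.IsoVia.refl _⟩

theorem Iso.symm {α β : LPOF Node L} (h : Iso α β) : Iso β α :=
  let ⟨_, hf⟩ := h
  hf.symm α.isLPOF

theorem Iso.trans {α β γ : LPOF Node L} (h : Iso α β) (h' : Iso β γ) : Iso α γ :=
  let ⟨_, hf⟩ := h
  let ⟨_, hg⟩ := h'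
  ⟨_, hf.trans hg⟩

/-- The one-node structure `⟨ℓ⟩ₓ`. -/
noncomputable def single (x : Node) (ℓ : L) : LPOF Node L where
  toPreLPOF := PreLPOF.single x ℓ
  isLPOF := PreLPOF.isLPOF_single x ℓ

/-- Guarded choice `guard(x, ℓ, α, β)`. -/
noncomputable def guard (x : Node) (ℓ : L) (hℓ : ℓ ≠ ⊥) (α β : LPOF Node L)
    (hd : Disjoint α.nodes β.nodes) (hx : x ∉ α.nodes ∪ β.nodes) : LPOF Node L where
  toPreLPOF := PreLPOF.guard x ℓ α.toPreLPOF β.toPreLPOF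
  isLPOF := PreLPOF.isLPOF_guard α.isLPOF β.isLPOF hℓ hd (fun h => hx (Or.inl h)) (fun h => hx (Or.inr h))

/-- Transport along a renaming of nodes. -/
noncomputable def image (f : Node → Node) (α : LPOF Node L) (hf : Set.InjOn f α.nodes) :
    LPOF Node L where
  toPreLPOF := α.toPreLPOF.image f
  isLPOF := α.isLPOF.image hf

theorem iso_image (f : Node → Node) (α : LPOF Node L) (hf : Set.InjOn f α.nodes) :
    Iso α (α.image f hf) := ⟨f, PreLPOF.isoVia_image α.isLPOF hf⟩

theorem exists_iso_disjoint (α : LPOF Node L) {S : Set Node} (hS : Sᶜ.Infinite) :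
    ∃ β, Iso α β ∧ Disjoint S β.nodes := by
  classical
  obtain ⟨e, he⟩ := Set.countable_iff_exists_injOn.1 α.isLPOF.countable
  have : Infinite ↥(Sᶜ) := hS.to_subtype
  let i := Infinite.natEmbedding ↥(Sᶜ)
  have hf : Set.InjOn (fun x => (i (e x) : Node)) α.nodes := fun x hx y hy h =>
    he hx hy (i.injective (Subtype.ext h))
  refine ⟨α.image _ hf, iso_image _ _ _, Set.disjoint_right.2 ?_⟩
  rintro _ ⟨x, -, rfl⟩
  exact (i (e x)).2

end LPOF

/-- Pomsets with formulae: isomorphism classes of labelled partial orders with formulae. -/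
def Pom (Node : Type u) (L : Type v) [PartialOrder L] [OrderBot L] : Type (max u v) :=
  {A : Set (LPOF Node L) // ∃ α, A = {β | LPOF.Iso α β}}

namespace Pom

variable {Node : Type u} {L : Type v} [PartialOrder L] [OrderBot L]

instance : Membership (LPOF Node L) (Pom Node L) where
  mem A α := α ∈ A.1

/-- The isomorphism class `[α]`. -/
def mk (α : LPOF Node L) : Pom Node L := ⟨{β | LPOF.Iso α β}, α, rfl⟩

theorem mem_iff_iso {A : Pom Node L} {α β : LPOF Node L} (hα : α ∈ A) :
    β ∈ A ↔ LPOF.Iso α β := by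
  obtain ⟨S, γ, rfl⟩ := A
  change LPOF.Iso γ α at hα
  exact ⟨fun h : LPOF.Iso γ β => hα.symm.trans h, fun h => (hα.trans h : LPOF.Iso γ β)⟩

theorem exists_mem (A : Pom Node L) : ∃ α, α ∈ A := by
  obtain ⟨S, γ, rfl⟩ := A
  exact ⟨γ, LPOF.Iso.refl γ⟩

theorem ext_of_mem {A B : Pom Node L} {α : LPOF Node L} (hA : α ∈ A) (hB : α ∈ B) : A = B :=
  Subtype.ext (Set.ext fun β => (mem_iff_iso hA).trans (mem_iff_iso hB).symm)

/-- The pomset order: every representative of `B` lies above some representative of `A`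
(equivalently, some representative of `B` lies above some representative of `A`). -/
instance : PartialOrder (Pom Node L) where
  le A B := ∀ β ∈ B, ∃ α ∈ A, α ≤ β
  le_refl A := fun β hβ => ⟨β, hβ, le_rfl⟩
  le_trans A B C h h' := fun γ hγ =>
    let ⟨_, hβ, hβγ⟩ := h' γ hγ
    let ⟨α, hα, hαβ⟩ := h _ hβ
    ⟨α, hα, hαβ.trans hβγ⟩
  le_antisymm A B h h' := by
    obtain ⟨β, hβ⟩ := B.exists_mem
    obtain ⟨α, hα, hαβ⟩ := h β hβ
    obtain ⟨β', hβ', hβα⟩ := h' α hα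
    obtain ⟨f, hf⟩ := (mem_iff_iso hβ).1 hβ'
    have := PreLPOF.IsoVia.eq_of_le α.isLPOF β.isLPOF β'.isLPOF hf hβα hαβ
    have e : α = β := LPOF.ext (congrArg PreLPOF.nodes this) (congrArg PreLPOF.lt this)
      (congrArg PreLPOF.label this) (congrArg PreLPOF.form this)
    exact ext_of_mem hα (e ▸ hβ)

/-- A pomset is finite if it has finitely many nodes. -/
def IsFinite (A : Pom Node L) : Prop := ∀ α ∈ A, α.nodes.Finite

/-- The finite approximations of a pomset. -/
def finApprox (A : Pom Node L) : Set (Pom Node L) := {B | B.IsFinite ∧ B ≤ A}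

/-- The singleton pomset `⟨ℓ⟩`. -/
noncomputable def singleton [Nonempty Node] (ℓ : L) : Pom Node L :=
  mk (LPOF.single (Classical.arbitrary Node) ℓ)

/-- The set `{guard(x, ℓ, α, β) | α ∈ A, β ∈ B, N_α ∩ N_β = ∅, x ∉ N_α ∪ N_β}`. -/
def guardSet (ℓ : L) (hℓ : ℓ ≠ ⊥) (A B : Pom Node L) : Set (LPOF Node L) :=
  {γ | ∃ (x : Node) (α β : LPOF Node L) (hd : Disjoint α.nodes β.nodes)
    (hx : x ∉ α.nodes ∪ β.nodes), α ∈ A ∧ β ∈ B ∧ γ = LPOF.guard x ℓ hℓ α β hd hx}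

theorem guardSet_isClass [Infinite Node] (ℓ : L) (hℓ : ℓ ≠ ⊥) (A B : Pom Node L)
    (hA : A.IsFinite) (hB : B.IsFinite) :
    ∃ γ, guardSet ℓ hℓ A B = {δ | LPOF.Iso γ δ} := by
  obtain ⟨α, hα⟩ := A.exists_mem
  obtain ⟨β₀, hβ₀⟩ := B.exists_mem
  obtain ⟨β, hβi, hd⟩ := β₀.exists_iso_disjoint (hA α hα).infinite_compl
  have hβ : β ∈ B := (mem_iff_iso hβ₀).2 hβi
  obtain ⟨x, hx⟩ := ((hA α hα).union (hB β hβ)).infinite_compl.nonempty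
  refine ⟨LPOF.guard x ℓ hℓ α β hd hx, Set.ext fun δ => ⟨?_, ?_⟩⟩
  · rintro ⟨x', α', β', hd', hx', hα', hβ', rfl⟩
    obtain ⟨f, hf⟩ := (mem_iff_iso hα).1 hα'
    obtain ⟨g, hg⟩ := (mem_iff_iso hβ).1 hβ'
    exact PreLPOF.isoVia_guard α.isLPOF β.isLPOF α'.isLPOF β'.isLPOF hf hg hd
      (fun h => hx (Or.inl h)) (fun h => hx (Or.inr h)) hd'
      (fun h => hx' (Or.inl h)) (fun h => hx' (Or.inr h))
  · rintro ⟨f, hf⟩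
    obtain ⟨h1, h2, h3, h4, h5, h6⟩ := PreLPOF.IsoVia.eq_guard α.isLPOF β.isLPOF δ.isLPOF hℓ hd
      (fun h => hx (Or.inl h)) (fun h => hx (Or.inr h)) hf
    refine ⟨f x, α.image f h1, β.image f h2, h3, fun h => h.elim h4 h5,
      (mem_iff_iso hα).2 (LPOF.iso_image _ _ _), (mem_iff_iso hβ).2 (LPOF.iso_image _ _ _), ?_⟩
    exact LPOF.ext (congrArg PreLPOF.nodes h6) (congrArg PreLPOF.lt h6)
      (congrArg PreLPOF.label h6) (congrArg PreLPOF.form h6)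

/-- Guarded choice on finite pomsets. -/
def guardFin [Infinite Node] (ℓ : L) (hℓ : ℓ ≠ ⊥) (A B : {A : Pom Node L // A.IsFinite}) :
    Pom Node L :=
  ⟨guardSet ℓ hℓ A.1 B.1, guardSet_isClass ℓ hℓ A.1 B.1 A.2 B.2⟩

/-- The supremum of a set of pomsets (an arbitrary value if there is none). -/
noncomputable def sup [Infinite Node] (S : Set (Pom Node L)) : Pom Node L :=
  open Classical in if h : ∃ P, IsLUB S P then h.choose else singleton ⊥

/-- The set `{guard(ℓ, A', B') | B' ≪ B}`. -/
def guardInner [Infinite Node] (ℓ : L) (hℓ : ℓ ≠ ⊥) (A' : {A : Pom Node L // A.IsFinite})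
    (B : Pom Node L) : Set (Pom Node L) :=
  {P | ∃ B' : {B : Pom Node L // B.IsFinite}, B'.1 ∈ finApprox B ∧ P = guardFin ℓ hℓ A' B'}

/-- The set `{sup_{B' ≪ B} guard(ℓ, A', B') | A' ≪ A}`. -/
def guardOuter [Infinite Node] (ℓ : L) (hℓ : ℓ ≠ ⊥) (A B : Pom Node L) : Set (Pom Node L) :=
  {P | ∃ A' : {A : Pom Node L // A.IsFinite}, A'.1 ∈ finApprox A ∧ P = sup (guardInner ℓ hℓ A' B)}

/-- Guarded choice on all pomsets: `sup_{A' ≪ A} sup_{B' ≪ B} guard(ℓ, A', B')`. -/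
noncomputable def guard [Infinite Node] (ℓ : L) (hℓ : ℓ ≠ ⊥) (A B : Pom Node L) : Pom Node L :=
  sup (guardOuter ℓ hℓ A B)

end Pom

end PomF

/-!
An embedding of `α` in `β` is a renaming of the nodes that makes `α` at most `β` (`EmbVia`); for
pomsets, `[α] ≤ [β]` says that there is one (`Pom.exists_embVia`, `Pom.le_of_embVia`). Embeddings
preserve levels, and levels are finite. Cutting `α` at level `n` and forgetting the labels at level
`n` gives a finite structure `trunc n α` below `α`, and three facts carry the proof.

* A pomset is determined by its truncations: if every `trunc n α` embeds in `β`, so does `α`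
  (`exists_embVia_of_trunc`). At each node, the embeddings take values in one finite level of `β`,
  so they converge pointwise along an ultrafilter, and the limit inherits every condition of an
  embedding because each condition concerns finitely many nodes.
* An ascending chain of structures has its union as an upper bound, and a finite structure below the
  union is below a member of the chain (`isLPOF_union`, `exists_le_of_le_union`). The hypotheses on
  `L` make ascending sequences of labels eventually constant. The levels of the union are finite:
  once the labels below level `k` are final, a new node at level `k` would have to lie above a node
  that is labelled `⊥` for good.
* In a directed set of pomsets, the truncations at level `n` have a greatest element
  (`exists_greatest_trunc`), since the union of a strictly ascending chain of bounded level would be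
  finite and therefore below a member of the chain.

The greatest truncations form an ascending sequence of finite pomsets, which can be represented by
an ascending sequence of structures because there are infinitely many nodes. The class of the union
is the supremum of the directed set, and finite pomsets are compact
(`Pom.exists_isLUB_of_directedOn`). Every pomset being the directed supremum of its finite
approximations, guarded choice is the extension of a monotone operation on compact elements:
`guard ℓ A B ≤ Q` holds iff `guard ℓ A' B' ≤ Q` for all finite `A' ≤ A` and `B' ≤ B`
(`Pom.guard_le_iff`). Agreement on finite pomsets and Scott continuity follow from this.

The pomset `⟨⊥⟩` is not least, as formulae are compared syntactically and the formula at a root may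
be any valid closed formula. It does lie below all guarded choices, whose root carries `true`, and
that is what Kleene's iteration needs (`exists_isLUB_iterate_isLeast_fixed`).
-/

namespace PomF

universe u v

namespace PreLPOF

variable {Node : Type u} {L : Type v} [PartialOrder L] [OrderBot L] {α β γ : PreLPOF Node L}

/-! ### Levels -/

/-- The axiom that a node labelled `⊥` has no immediate successor excludes all nodes above it. -/
theorem IsLPOF.not_lt_of_mem_bots (hα : α.IsLPOF) {b y : Node} (hb : b ∈ α.bots) :
    ¬ α.lt b y := by
  intro h
  have : y ∈ α.aboveSet α.bots := by
    simp only [aboveSet, Set.mem_iUnion]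
    exact ⟨b, hb, h⟩
  rw [← Le.aboveSet_eq hα hα (Le.refl hα)] at this
  exact this.2 this.1

theorem IsLPOF.eq_root_or_lt (hα : α.IsLPOF) {r : Node} (hr : r ∈ α.mins) :
    ∀ x ∈ α.nodes, x = r ∨ α.lt r x := by
  obtain ⟨r', -, hu⟩ := hα.single_root
  refine hα.induct fun x hx ih => ?_
  by_cases hm : x ∈ α.mins
  · exact Or.inl ((hu x hm).trans (hu r hr).symm)
  · rw [hα.mem_mins_iff] at hm
    push Not at hm
    obtain ⟨y, hy⟩ := hm hx
    rcases ih y hy with rfl | h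
    · exact Or.inr hy
    · exact Or.inr (hα.trans _ _ _ h hy)

theorem PathTo.snoc {x y : Node} {n : ℕ} (h : α.PathTo x n) (hy : y ∈ α.succ x) :
    α.PathTo y (n + 1) := by
  obtain ⟨c, h0, rfl, hc⟩ := h
  refine ⟨fun i => if i ≤ n then c i else y, by simpa using h0, by simp, fun i hi => ?_⟩
  rcases (Nat.lt_succ_iff_lt_or_eq.1 hi) with h | rfl
  · have h1 : i ≤ n := h.le
    have h2 : i + 1 ≤ n := h
    simpa only [h1, h2, if_true] using hc i h
  · simpa using hy

/-- A path to `y` extends to a strictly longer path to any node above `y`. -/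
theorem IsLPOF.exists_longer_path (hα : α.IsLPOF) {x y : Node} {k : ℕ} (hxy : α.lt y x)
    (hk : α.PathTo y k) : ∃ m, k < m ∧ α.PathTo x m := by
  suffices H : ∀ n : ℕ, ∀ x y k, α.lt y x → α.PathTo y k →
      (α.below x ∩ α.above y).ncard < n → ∃ m, k < m ∧ α.PathTo x m from
    H _ x y k hxy hk (Nat.lt_succ_self _)
  intro n
  induction n with
  | zero => intro _ _ _ _ _ h; omega
  | succ n ih =>
    intro x y k hxy hk hn
    by_cases hs : x ∈ α.succ y
    · exact ⟨k + 1, Nat.lt_succ_self k, hk.snoc hs⟩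
    · simp only [succ, above, Set.mem_ofPred_eq, not_and, not_not] at hs
      obtain ⟨z, hyz, hzx⟩ := hs hxy
      have hfin : (α.below x ∩ α.above y).Finite :=
        (hα.finite_below x (hα.lt_mem _ _ hxy).2).subset fun _ h => h.1
      have h1 : (α.below z ∩ α.above y).ncard < n := by
        refine (Set.ncard_lt_ncard ⟨?_, fun hh => ?_⟩ hfin).trans_le (Nat.lt_succ_iff.1 hn)
        · exact fun w hw => ⟨hα.trans _ _ _ hw.1 hzx, hw.2⟩
        · exact hα.irrefl z (hh ⟨hzx, hyz⟩).1
      have h2 : (α.below x ∩ α.above z).ncard < n := by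
        refine (Set.ncard_lt_ncard ⟨?_, fun hh => ?_⟩ hfin).trans_le (Nat.lt_succ_iff.1 hn)
        · exact fun w hw => ⟨hw.1, hα.trans _ _ _ hyz hw.2⟩
        · exact hα.irrefl z (hh ⟨hzx, hyz⟩).2
      obtain ⟨m, hkm, hm⟩ := ih z y k hyz hk h1
      obtain ⟨m', hm', hx⟩ := ih x z m hzx hm h2
      exact ⟨m', hkm.trans hm', hx⟩

theorem IsLPOF.pathTo_bddAbove (hα : α.IsLPOF) {x : Node} (hx : x ∈ α.nodes) :
    BddAbove {n | α.PathTo x n} :=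
  ⟨_, fun _ hn => PathTo.le_ncard hα.irrefl hα.trans (hα.finite_below x hx) hn⟩

theorem IsLPOF.pathTo_lev (hα : α.IsLPOF) {x : Node} (hx : x ∈ α.nodes) :
    α.PathTo x (α.lev x) := by
  refine Nat.sSup_mem (s := {n | α.PathTo x n}) ?_ (hα.pathTo_bddAbove hx)
  obtain ⟨r, hr, -⟩ := hα.single_root
  have h0 : α.PathTo r 0 := ⟨fun _ => r, hr, rfl, fun i hi => absurd hi (Nat.not_lt_zero i)⟩
  rcases hα.eq_root_or_lt hr x hx with rfl | h
  · exact ⟨0, h0⟩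
  · obtain ⟨m, -, hm⟩ := hα.exists_longer_path h h0
    exact ⟨m, hm⟩

theorem IsLPOF.lev_lt_lev (hα : α.IsLPOF) {x y : Node} (h : α.lt y x) : α.lev y < α.lev x := by
  obtain ⟨m, hm, hx⟩ := hα.exists_longer_path h (hα.pathTo_lev (hα.lt_mem _ _ h).1)
  exact hm.trans_le (le_csSup (hα.pathTo_bddAbove (hα.lt_mem _ _ h).2) hx)

/-- The level is the rank for the well-founded relation `<`; this determines it without any
reference to paths. -/
theorem IsLPOF.lev_le_iff (hα : α.IsLPOF) {x : Node} (hx : x ∈ α.nodes) {n : ℕ} :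
    α.lev x ≤ n ↔ ∀ y, α.lt y x → α.lev y < n := by
  refine ⟨fun h y hy => (hα.lev_lt_lev hy).trans_le h, fun h => ?_⟩
  obtain ⟨c, h0, hn, hc⟩ := hα.pathTo_lev hx
  rcases hm : α.lev x with _ | m
  · exact Nat.zero_le n
  · rw [hm] at hn hc
    have hlt : α.lt (c m) x := hn ▸ (hc m (Nat.lt_succ_self m)).1
    have hp : α.PathTo (c m) m := ⟨c, h0, rfl, fun i hi => hc i (hi.trans (Nat.lt_succ_self m))⟩
    exact (le_csSup (hα.pathTo_bddAbove (hα.lt_mem _ _ hlt).1) hp).trans_lt (h _ hlt)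

theorem IsLPOF.exists_lt_lev_eq (hα : α.IsLPOF) {n : ℕ} :
    ∀ x ∈ α.nodes, n < α.lev x → ∃ y, α.lt y x ∧ α.lev y = n := by
  refine hα.induct fun x hx ih hn => ?_
  rw [← not_le, hα.lev_le_iff hx] at hn
  push Not at hn
  obtain ⟨y, hyx, hy⟩ := hn
  rcases hy.eq_or_lt with h | h
  · exact ⟨y, hyx, h.symm⟩
  · obtain ⟨z, hzy, hz⟩ := ih y hyx h
    exact ⟨z, hα.trans _ _ _ hzy hyx, hz⟩

/-! ### Embeddings -/

/-- `f` carries `α` to a structure that is at most `β`: the order of labelled partial orders, up to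
renaming of nodes. The condition on immediate successors is replaced by the equivalent condition
`cover`, that all nodes of `β` outside the image lie above the image of a node of `α` that is
labelled `⊥`. -/
structure EmbVia (f : Node → Node) (α β : PreLPOF Node L) : Prop where
  mapsTo : Set.MapsTo f α.nodes β.nodes
  injOn : Set.InjOn f α.nodes
  lt_iff : ∀ x ∈ α.nodes, ∀ y ∈ α.nodes, (β.lt (f x) (f y) ↔ α.lt x y)
  down : ∀ x ∈ α.nodes, ∀ y, β.lt y (f x) → y ∈ f '' α.nodes
  label_le : ∀ x ∈ α.nodes, α.label x ≤ β.label (f x)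
  form_eq : ∀ x ∈ α.nodes, β.form (f x) = (α.form x).rename f
  cover : ∀ y ∈ β.nodes, y ∈ f '' α.nodes ∨ ∃ b ∈ α.bots, β.lt (f b) y

theorem IsoVia.embVia (hβ : β.IsLPOF) {f : Node → Node} (h : IsoVia f α β) : EmbVia f α β where
  mapsTo := h.bij.mapsTo
  injOn := h.bij.injOn
  lt_iff := h.lt_iff
  down := fun _ _ _ hy => h.bij.surjOn (hβ.lt_mem _ _ hy).1
  label_le := fun x hx => (h.label_eq x hx).ge
  form_eq := h.form_eq
  cover := fun _ hy => Or.inl (h.bij.surjOn hy)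

theorem Le.embVia (hα : α.IsLPOF) (hβ : β.IsLPOF) (h : α.Le β) :
    EmbVia (fun x => x) α β where
  mapsTo := h.subset
  injOn := Set.injOn_id _
  lt_iff := fun x hx y hy => ⟨fun hh => (h.lt_iff x y).2 ⟨hh, hx, hy⟩,
    fun hh => ((h.lt_iff x y).1 hh).1⟩
  down := fun x hx y hy => ⟨y, h.down x hx hy, rfl⟩
  label_le := h.label_le
  form_eq := fun x hx => by rw [Form.rename_id, h.form_eq x hx]
  cover := fun y hy => by
    by_cases hyα : y ∈ α.nodes
    · exact Or.inl ⟨y, hyα, rfl⟩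
    · have : y ∈ β.aboveSet α.bots := by rw [← Le.aboveSet_eq hα hβ h]; exact ⟨hy, hyα⟩
      simp only [aboveSet, Set.mem_iUnion] at this
      obtain ⟨b, hb, hby⟩ := this
      exact Or.inr ⟨b, hb, hby⟩

theorem EmbVia.le (hα : α.IsLPOF) (hβ : β.IsLPOF) (h : EmbVia (fun x => x) α β) : α.Le β where
  subset := h.mapsTo
  down := fun y hy z hz => by
    obtain ⟨w, hw, rfl⟩ := h.down y hy z hz
    exact hw
  lt_iff := fun x y => ⟨fun hxy => by
    have := hα.lt_mem _ _ hxy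
    exact ⟨(h.lt_iff x this.1 y this.2).2 hxy, this⟩,
    fun ⟨hxy, hx, hy⟩ => (h.lt_iff x hx y hy).1 hxy⟩
  label_le := h.label_le
  form_eq := fun x hx => by rw [h.form_eq x hx, Form.rename_id]
  succ_eq := fun x hx => by
    have hd : ∀ y ∈ α.nodes, ∀ z, β.lt z y → z ∈ α.nodes := fun y hy z hz => by
      obtain ⟨w, hw, rfl⟩ := h.down y hy z hz
      exact hw
    ext y
    simp only [Set.mem_sdiff, aboveSet, Set.mem_iUnion, not_exists]
    constructor
    · rintro ⟨hxy, hno⟩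
      have hy := (hα.lt_mem _ _ hxy).2
      refine ⟨⟨(h.lt_iff x hx y hy).2 hxy, ?_⟩, fun b hb hby => ?_⟩
      · rintro ⟨z, hxz, hzy⟩
        have hz := hd y hy z hzy
        exact hno ⟨z, (h.lt_iff x hx z hz).1 hxz, (h.lt_iff z hz y hy).1 hzy⟩
      · exact hα.not_lt_of_mem_bots hb ((h.lt_iff b hb.1 y hy).1 hby)
    · rintro ⟨⟨hxy, hno⟩, hb⟩
      have hy : y ∈ α.nodes := by
        rcases h.cover y (hβ.lt_mem _ _ hxy).2 with ⟨w, hw, rfl⟩ | ⟨b, hb', hby⟩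
        · exact hw
        · exact absurd hby (hb b hb')
      refine ⟨(h.lt_iff x hx y hy).1 hxy, ?_⟩
      rintro ⟨z, hxz, hzy⟩
      have hz := (hα.lt_mem _ _ hxz).2
      exact hno ⟨z, (h.lt_iff x hx z hz).2 hxz, (h.lt_iff z hz y hy).2 hzy⟩

theorem EmbVia.congr (hα : α.IsLPOF) {f g : Node → Node} (h : EmbVia f α β)
    (hfg : Set.EqOn f g α.nodes) : EmbVia g α β where
  mapsTo := h.mapsTo.congr hfg
  injOn := h.injOn.congr hfg
  lt_iff := fun x hx y hy => by rw [← hfg hx, ← hfg hy, h.lt_iff x hx y hy]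
  down := fun x hx y hy => by
    rw [← hfg.image_eq]
    exact h.down x hx y ((hfg hx).symm ▸ hy)
  label_le := fun x hx => (hfg hx) ▸ h.label_le x hx
  form_eq := fun x hx => by
    rw [← hfg hx, h.form_eq x hx]
    exact Form.rename_congr _ fun y hy => hfg (hα.free_subset hx hy)
  cover := fun y hy => by
    rw [← hfg.image_eq]
    refine (h.cover y hy).imp_right ?_
    rintro ⟨b, hb, hby⟩
    exact ⟨b, hb, (hfg hb.1) ▸ hby⟩

theorem EmbVia.trans (hγ : γ.IsLPOF) {f g : Node → Node} (h : EmbVia f α β) (h' : EmbVia g β γ) :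
    EmbVia (g ∘ f) α γ where
  mapsTo := h'.mapsTo.comp h.mapsTo
  injOn := h'.injOn.comp h.injOn h.mapsTo
  lt_iff := fun x hx y hy => by
    rw [Function.comp, Function.comp, h'.lt_iff _ (h.mapsTo hx) _ (h.mapsTo hy), h.lt_iff x hx y hy]
  down := fun x hx y hy => by
    obtain ⟨z, hz, rfl⟩ := h'.down _ (h.mapsTo hx) y hy
    obtain ⟨w, hw, rfl⟩ := h.down x hx z ((h'.lt_iff z hz _ (h.mapsTo hx)).1 hy)
    exact ⟨w, hw, rfl⟩
  label_le := fun x hx => (h.label_le x hx).trans (h'.label_le _ (h.mapsTo hx))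
  form_eq := fun x hx => by
    rw [Function.comp, h'.form_eq _ (h.mapsTo hx), h.form_eq x hx, Form.rename_rename]
  cover := fun y hy => by
    have key : ∀ z ∈ β.nodes, (z ∈ f '' α.nodes ∧ (z ∈ β.bots → ∃ b ∈ α.bots, z = f b)) ∨
        ∃ b ∈ α.bots, γ.lt (g (f b)) (g z) := by
      intro z hz
      rcases h.cover z hz with ⟨w, hw, rfl⟩ | ⟨b, hb, hbz⟩
      · exact Or.inl ⟨⟨w, hw, rfl⟩, fun hb =>
          ⟨w, ⟨hw, le_bot_iff.1 ((h.label_le w hw).trans hb.2.le)⟩, rfl⟩⟩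
      · exact Or.inr ⟨b, hb, (h'.lt_iff _ (h.mapsTo hb.1) z hz).2 hbz⟩
    rcases h'.cover y hy with ⟨z, hz, rfl⟩ | ⟨b, hb, hby⟩
    · refine (key z hz).imp_left ?_
      rintro ⟨⟨w, hw, rfl⟩, -⟩
      exact ⟨w, hw, rfl⟩
    · right
      rcases key b hb.1 with ⟨-, hh⟩ | ⟨c, hc, hcb⟩
      · obtain ⟨c, hc, rfl⟩ := hh hb
        exact ⟨c, hc, hby⟩
      · exact ⟨c, hc, hγ.trans _ _ _ hcb hby⟩

theorem EmbVia.lev_eq (hα : α.IsLPOF) (hβ : β.IsLPOF) {f : Node → Node} (h : EmbVia f α β) :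
    ∀ x ∈ α.nodes, β.lev (f x) = α.lev x := by
  refine hα.induct fun x hx ih => eq_of_forall_ge_iff fun n => ?_
  rw [hα.lev_le_iff hx, hβ.lev_le_iff (h.mapsTo hx)]
  constructor
  · intro hh y hy
    have hyα := (hα.lt_mem _ _ hy).1
    rw [← ih y hy]
    exact hh _ ((h.lt_iff y hyα x hx).2 hy)
  · intro hh y hy
    obtain ⟨z, hz, rfl⟩ := h.down x hx y hy
    have hzx := (h.lt_iff z hz x hx).1 hy
    rw [ih z hzx]
    exact hh z hzx

theorem Le.lev_eq (hα : α.IsLPOF) (hβ : β.IsLPOF) (h : α.Le β) {x : Node} (hx : x ∈ α.nodes) :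
    β.lev x = α.lev x :=
  (h.embVia hα hβ).lev_eq hα hβ x hx

/-- Two structures below a common one are comparable as soon as their nodes and labels are. -/
theorem Le.of_le_of_le (hα : α.IsLPOF) (hβ : β.IsLPOF) (hγ : γ.IsLPOF) (h : α.Le γ) (h' : β.Le γ)
    (hs : α.nodes ⊆ β.nodes) (hl : ∀ x ∈ α.nodes, α.label x ≤ β.label x) : α.Le β := by
  have e := h.embVia hα hγ
  have e' := h'.embVia hβ hγ
  refine EmbVia.le hα hβ ⟨hs, Set.injOn_id _, fun x hx y hy => ?_, fun x hx y hy => ?_, hl,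
    fun x hx => ?_, fun y hy => ?_⟩
  · rw [← e'.lt_iff x (hs hx) y (hs hy), e.lt_iff x hx y hy]
  · have hyβ := (hβ.lt_mem _ _ hy).1
    exact e.down x hx y ((e'.lt_iff y hyβ x (hs hx)).2 hy)
  · rw [Form.rename_id, h'.form_eq x (hs hx), h.form_eq x hx]
  · refine (e.cover y (h'.subset hy)).imp_right ?_
    rintro ⟨b, hb, hby⟩
    exact ⟨b, hb, (e'.lt_iff b (hs hb.1) y hy).1 hby⟩

/-! ### Truncation -/

/-- The part of `α` up to level `n`. The labels at level `n` are forgotten, so that every node that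
is cut off lies above a node labelled `⊥`. -/
noncomputable def trunc (n : ℕ) (α : PreLPOF Node L) : PreLPOF Node L where
  nodes := {x | x ∈ α.nodes ∧ α.lev x ≤ n}
  lt := fun x y => α.lt x y ∧ α.lev y ≤ n
  label := fun x => if α.lev x < n then α.label x else ⊥
  form := open Classical in fun x => if x ∈ α.nodes ∧ α.lev x ≤ n then α.form x else Form.tt

theorem trunc_label_of_lt {n : ℕ} {x : Node} (h : α.lev x < n) :
    (α.trunc n).label x = α.label x := if_pos h

theorem trunc_label_le (n : ℕ) (x : Node) : (α.trunc n).label x ≤ α.label x := by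
  simp only [trunc]
  split_ifs
  · exact le_rfl
  · exact bot_le

theorem trunc_form {n : ℕ} {x : Node} (h : x ∈ (α.trunc n).nodes) :
    (α.trunc n).form x = α.form x := if_pos h

theorem IsLPOF.trunc_nodes_finite (hα : α.IsLPOF) (n : ℕ) : (α.trunc n).nodes.Finite :=
  hα.finite_level_le n

theorem IsLPOF.trunc (hα : α.IsLPOF) (n : ℕ) : (α.trunc n).IsLPOF := by
  have hlt : ∀ {x y}, α.lt x y → α.lev y ≤ n → x ∈ (α.trunc n).nodes := fun h hy =>
    ⟨(hα.lt_mem _ _ h).1, (hα.lev_lt_lev h).le.trans hy⟩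
  have hpred : ∀ x ∈ (α.trunc n).nodes, (α.trunc n).pred x = α.pred x := by
    intro x hx
    ext y
    refine and_congr (and_iff_left hx.2) (not_congr (exists_congr fun z => ?_))
    exact ⟨fun h => ⟨h.1.1, h.2.1⟩, fun h => ⟨⟨h.1, (hlt h.2 hx.2).2⟩, h.2, hx.2⟩⟩
  refine ⟨fun x y h => ⟨hlt h.1 h.2, (hα.lt_mem _ _ h.1).2, h.2⟩, fun x hx => ?_,
    fun x hx => if_neg hx, (hα.trunc_nodes_finite n).countable, fun x h => hα.irrefl x h.1,
    fun x y z h h' => ⟨hα.trans _ _ _ h.1 h'.1, h'.2⟩, fun x hx => ?_,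
    fun k => (hα.trunc_nodes_finite n).subset fun x h => h.1, ?_, fun x hx hb => ?_,
    fun x hx => ?_, fun x hx => ?_, fun x y h => ?_⟩
  · by_cases h : x ∈ α.nodes
    · exact if_neg fun hh => hx ⟨h, hh.le⟩
    · exact le_bot_iff.1 ((trunc_label_le n x).trans (hα.label_off x h).le)
  · exact (hα.finite_below x hx.1).subset fun y h => h.1
  · obtain ⟨r, hr, hu⟩ := hα.single_root
    have hrn : r ∈ (α.trunc n).nodes :=
      ⟨hr.1, (hα.lev_le_iff hr.1).2 fun y hy => absurd hy ((hα.mem_mins_iff.1 hr).2 y)⟩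
    refine ⟨r, ⟨hrn, (hpred r hrn).trans hr.2⟩, fun x hx => hu x ⟨hx.1.1, ?_⟩⟩
    exact (hpred x hx.1).symm.trans hx.2
  · refine Set.eq_empty_of_forall_notMem fun y hy => ?_
    have hyx : α.lt x y ∧ α.lev y ≤ n := hy.1
    rw [trunc_label_of_lt ((hα.lev_lt_lev hyx.1).trans_le hyx.2)] at hb
    exact hα.not_lt_of_mem_bots ⟨hx.1, hb⟩ hyx.1
  · rw [trunc_form hx]
    exact hα.form_sat x hx.1
  · rw [trunc_form hx]
    exact fun y hy => ⟨hα.form_free x hx.1 hy, hx.2⟩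
  · rw [trunc_form (hlt h.1 h.2), trunc_form ⟨(hα.lt_mem _ _ h.1).2, h.2⟩]
    exact hα.form_entails x y h.1

theorem IsLPOF.trunc_le (hα : α.IsLPOF) (n : ℕ) : (α.trunc n).Le α := by
  refine EmbVia.le (hα.trunc n) hα ⟨fun x hx => hx.1, Set.injOn_id _, fun x _ y hy => ?_,
    fun x hx y hy => ?_, fun x _ => trunc_label_le n x, fun x hx => ?_, fun y hy => ?_⟩
  · exact (and_iff_left hy.2).symm
  · exact ⟨y, ⟨(hα.lt_mem _ _ hy).1, (hα.lev_lt_lev hy).le.trans hx.2⟩, rfl⟩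
  · rw [Form.rename_id, trunc_form hx]
  · by_cases hn : α.lev y ≤ n
    · exact Or.inl ⟨y, ⟨hy, hn⟩, rfl⟩
    · obtain ⟨b, hby, rfl⟩ := hα.exists_lt_lev_eq y hy (not_le.1 hn)
      exact Or.inr ⟨b, ⟨⟨(hα.lt_mem _ _ hby).1, le_rfl⟩, if_neg (lt_irrefl _)⟩, hby⟩

theorem Le.trunc_mono (hα : α.IsLPOF) (hβ : β.IsLPOF) (h : α.Le β) {m n : ℕ} (hmn : m ≤ n) :
    (α.trunc m).Le (β.trunc n) := by
  refine Le.of_le_of_le (hα.trunc m) (hβ.trunc n) hβ (Le.trans (hα.trunc m) hα hβ (hα.trunc_le m) h)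
    (hβ.trunc_le n) (fun x hx => ⟨h.subset hx.1, ?_⟩) fun x hx => ?_
  · rw [h.lev_eq hα hβ hx.1]
    exact hx.2.trans hmn
  · simp only [trunc, h.lev_eq hα hβ hx.1]
    split_ifs with h1 h2
    · exact h.label_le x hx.1
    · omega
    · exact bot_le
    · exact le_rfl

/-- A finite structure below `γ` is below all sufficiently deep truncations of `γ`. -/
theorem Le.exists_le_trunc (hα : α.IsLPOF) (hγ : γ.IsLPOF) (h : α.Le γ) (hf : α.nodes.Finite) :
    ∃ n, ∀ m, n ≤ m → α.Le (γ.trunc m) := by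
  obtain ⟨n, hn⟩ := (hf.image γ.lev).bddAbove
  refine ⟨n + 1, fun m hm => ?_⟩
  have hlev : ∀ x ∈ α.nodes, γ.lev x < m := fun x hx =>
    (Nat.lt_succ_of_le (hn ⟨x, hx, rfl⟩)).trans_le hm
  refine Le.of_le_of_le hα (hγ.trunc m) hγ h (hγ.trunc_le m)
    (fun x hx => ⟨h.subset hx, (hlev x hx).le⟩) fun x hx => ?_
  rw [trunc_label_of_lt (hlev x hx)]
  exact h.label_le x hx

/-- An embedding of each truncation of `α` into `β` yields an embedding of `α`: since levels are
finite and preserved, the embeddings have a pointwise limit along an ultrafilter. -/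
theorem exists_embVia_of_trunc (hα : α.IsLPOF) (hβ : β.IsLPOF)
    (h : ∀ n, ∃ f, EmbVia f (α.trunc n) β) : ∃ f, EmbVia f α β := by
  choose f hf using h
  let U : Ultrafilter ℕ := Filter.hyperfilter ℕ
  have hU : ∀ n, ∀ᶠ k in (U : Filter ℕ), n < k := fun n =>
    Nat.hyperfilter_le_atTop (Filter.eventually_gt_atTop n)
  have hlim : ∀ x, ∃ y, x ∈ α.nodes → ∀ᶠ k in (U : Filter ℕ), f k x = y := by
    intro x
    by_cases hx : x ∈ α.nodes
    · have hev : ∀ᶠ k in (U : Filter ℕ), ∃ y ∈ {y | y ∈ β.nodes ∧ β.lev y = α.lev x},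
          f k x = y := by
        filter_upwards [hU (α.lev x)] with k hk
        have hxk : x ∈ (α.trunc k).nodes := ⟨hx, hk.le⟩
        refine ⟨_, ⟨(hf k).mapsTo hxk, ?_⟩, rfl⟩
        rw [(hf k).lev_eq (hα.trunc k) hβ x hxk, (hα.trunc_le k).lev_eq (hα.trunc k) hα hxk]
      rw [Ultrafilter.eventually_exists_mem_iff (hβ.finite_level _)] at hev
      obtain ⟨y, -, hy⟩ := hev
      exact ⟨y, fun _ => hy⟩
    · exact ⟨x, fun h => absurd h hx⟩
  choose g hg using hlim
  have hfin : ∀ S : Set Node, S.Finite → S ⊆ α.nodes →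
      ∃ k, S ⊆ (α.trunc k).nodes ∧ (∀ x ∈ S, α.lev x < k) ∧ ∀ x ∈ S, f k x = g x := by
    intro S hS hSα
    have h1 : ∀ᶠ k in (U : Filter ℕ), ∀ x ∈ S, α.lev x < k ∧ f k x = g x := by
      rw [Filter.eventually_all_finite hS]
      exact fun x hx => (hU _).and (hg x (hSα hx))
    obtain ⟨k, hk⟩ := h1.exists
    exact ⟨k, fun x hx => ⟨hSα hx, (hk x hx).1.le⟩, fun x hx => (hk x hx).1,
      fun x hx => (hk x hx).2⟩
  have hbelow : ∀ x ∈ α.nodes, (insert x (α.below x)).Finite ∧ insert x (α.below x) ⊆ α.nodes :=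
    fun x hx => ⟨(hα.finite_below x hx).insert x,
      Set.insert_subset hx fun y hy => (hα.lt_mem _ _ hy).1⟩
  have hpair : ∀ x ∈ α.nodes, ∀ y ∈ α.nodes, ∃ k, x ∈ (α.trunc k).nodes ∧ y ∈ (α.trunc k).nodes ∧
      f k x = g x ∧ f k y = g y := by
    intro x hx y hy
    obtain ⟨k, h1, -, h2⟩ := hfin {x, y} (by simp) (by simp [Set.insert_subset_iff, hx, hy])
    exact ⟨k, h1 (by simp), h1 (by simp), h2 _ (by simp), h2 _ (by simp)⟩
  refine ⟨g, fun x hx => ?_, fun x hx y hy hxy => ?_, fun x hx y hy => ?_, fun x hx y hy => ?_,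
    fun x hx => ?_, fun x hx => ?_, fun y hy => ?_⟩
  · obtain ⟨k, h1, -, h2, -⟩ := hpair x hx x hx
    exact h2 ▸ (hf k).mapsTo h1
  · obtain ⟨k, h1, h1', h2, h2'⟩ := hpair x hx y hy
    exact (hf k).injOn h1 h1' (by rw [h2, h2', hxy])
  · obtain ⟨k, h1, h1', h2, h2'⟩ := hpair x hx y hy
    rw [← h2, ← h2', (hf k).lt_iff x h1 y h1']
    exact and_iff_left h1'.2
  · obtain ⟨k, h1, -, h2⟩ := hfin _ (hbelow x hx).1 (hbelow x hx).2
    have hxk := h1 (Set.mem_insert _ _)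
    rw [← h2 x (Set.mem_insert _ _)] at hy
    obtain ⟨z, hz, rfl⟩ := (hf k).down x hxk y hy
    have hzx := ((hf k).lt_iff z hz x hxk).1 hy
    exact ⟨z, hz.1, (h2 z (Set.mem_insert_of_mem _ hzx.1)).symm⟩
  · obtain ⟨k, h1, h2, h3⟩ := hfin {x} (by simp) (by simpa using hx)
    have := (hf k).label_le x (h1 rfl)
    rwa [h3 x rfl, trunc_label_of_lt (h2 x rfl)] at this
  · obtain ⟨k, h1, -, h2⟩ := hfin _ (hbelow x hx).1 (hbelow x hx).2
    have hxk := h1 (Set.mem_insert _ _)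
    rw [← h2 x (Set.mem_insert _ _), (hf k).form_eq x hxk, trunc_form hxk]
    exact Form.rename_congr _ fun y hy => h2 y (Set.mem_insert_of_mem _ (hα.form_free x hx hy))
  · -- Nodes of `α` that are not deeper than `y` are the only ones that matter.
    obtain ⟨k, h1, h2, h3⟩ := hfin {x | x ∈ α.nodes ∧ α.lev x ≤ β.lev y}
      (hα.finite_level_le _) fun x hx => hx.1
    have hlev : ∀ x ∈ (α.trunc k).nodes, β.lev (f k x) = α.lev x := fun x hx => by
      rw [(hf k).lev_eq (hα.trunc k) hβ x hx, (hα.trunc_le k).lev_eq (hα.trunc k) hα hx]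
    rcases (hf k).cover y hy with ⟨x, hx, rfl⟩ | ⟨b, hb, hby⟩
    · exact Or.inl ⟨x, hx.1, (h3 x ⟨hx.1, (hlev x hx).ge⟩).symm⟩
    · have hbm : b ∈ {x | x ∈ α.nodes ∧ α.lev x ≤ β.lev y} :=
        ⟨hb.1.1, by rw [← hlev b hb.1]; exact (hβ.lev_lt_lev hby).le⟩
      refine Or.inr ⟨b, ⟨hb.1.1, ?_⟩, h3 b hbm ▸ hby⟩
      rw [← trunc_label_of_lt (h2 b hbm)]
      exact hb.2

/-! ### Unions of chains -/

/-- In a poset with suprema of directed sets and finite principal ideals, ascending sequences are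
eventually constant. -/
theorem eventually_const_of_monotone
    (hL_dcpo : ∀ D : Set L, D.Nonempty → DirectedOn (· ≤ ·) D → ∃ l, IsLUB D l)
    (hL_fin : ∀ l : L, {m | m < l}.Finite) (s : ℕ → L) (hs : Monotone s) :
    ∃ n, ∀ k, n ≤ k → s k = s n := by
  obtain ⟨l, hl⟩ := hL_dcpo (Set.range s) (Set.range_nonempty s) hs.directed_le.directedOn_range
  have hfin : (Set.range s).Finite := by
    refine ((hL_fin l).insert l).subset ?_
    rintro _ ⟨n, rfl⟩
    exact (hl.1 ⟨n, rfl⟩).eq_or_lt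
  obtain ⟨_, ⟨n, rfl⟩, hn⟩ := hfin.exists_maximal (Set.range_nonempty s)
  exact ⟨n, fun k hk => (hn ⟨k, rfl⟩ (hs hk)).antisymm (hs hk)⟩

section chain

variable {m : ℕ → PreLPOF Node L}

/-- The first index from which on nothing changes at the node `x` in the chain `m`. Such an index
exists if the chain is ascending and labels stabilise, see `stage_spec`. -/
noncomputable def stage (m : ℕ → PreLPOF Node L) (x : Node) : ℕ :=
  sInf {n | ∀ k, n ≤ k → (x ∈ (m k).nodes ↔ x ∈ (m n).nodes) ∧ (m k).label x = (m n).label x ∧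
    (m k).form x = (m n).form x}

/-- The union of a chain, with the eventual label and formula at each node. -/
noncomputable def union (m : ℕ → PreLPOF Node L) : PreLPOF Node L where
  nodes := ⋃ n, (m n).nodes
  lt := fun x y => ∃ n, (m n).lt x y
  label := fun x => (m (stage m x)).label x
  form := fun x => (m (stage m x)).form x

variable (hm : ∀ n, (m n).IsLPOF) (hle : ∀ i j, i ≤ j → (m i).Le (m j))
include hm hle

theorem label_mono_of_chain (x : Node) : Monotone fun n => (m n).label x := by
  intro i j hij
  by_cases hx : x ∈ (m i).nodes
  · exact (hle i j hij).label_le x hx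
  · exact ((hm i).label_off x hx).le.trans bot_le

theorem union_lt_iff {n : ℕ} {x y : Node} (hx : x ∈ (m n).nodes) (hy : y ∈ (m n).nodes) :
    (union m).lt x y ↔ (m n).lt x y := by
  refine ⟨?_, fun h => ⟨n, h⟩⟩
  rintro ⟨k, hk⟩
  have h1 := (((hle k _ (le_max_left k n)).lt_iff x y).1 hk).1
  exact ((hle n _ (le_max_right k n)).lt_iff x y).2 ⟨h1, hx, hy⟩

theorem union_down {n : ℕ} {x y : Node} (hx : x ∈ (m n).nodes) (h : (union m).lt y x) :
    (m n).lt y x := by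
  obtain ⟨k, hk⟩ := h
  have h1 := (((hle k _ (le_max_left k n)).lt_iff y x).1 hk).1
  have hy := (hle n _ (le_max_right k n)).down x hx h1
  exact ((hle n _ (le_max_right k n)).lt_iff y x).2 ⟨h1, hy, hx⟩

theorem union_below {n : ℕ} {x : Node} (hx : x ∈ (m n).nodes) :
    (union m).below x = (m n).below x :=
  Set.ext fun _ => ⟨union_down hm hle hx, fun h => ⟨n, h⟩⟩

theorem union_pred {n : ℕ} {x : Node} (hx : x ∈ (m n).nodes) :
    (union m).pred x = (m n).pred x := by
  ext y
  refine and_congr (Set.ext_iff.1 (union_below hm hle hx) y)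
    (not_congr (exists_congr fun z => ⟨fun h => ?_, fun h => ⟨⟨n, h.1⟩, n, h.2⟩⟩))
  have hz := union_down hm hle hx h.2
  exact ⟨union_down hm hle ((hm n).lt_mem _ _ hz).1 h.1, hz⟩

theorem exists_ge_lt_of_union_lt {x y : Node} (h : (union m).lt x y) (k : ℕ) :
    ∃ n, k ≤ n ∧ (m n).lt x y := by
  obtain ⟨n, hn⟩ := h
  exact ⟨max k n, le_max_left k n, (((hle n _ (le_max_right k n)).lt_iff x y).1 hn).1⟩

variable (hL : ∀ s : ℕ → L, Monotone s → ∃ n, ∀ k, n ≤ k → s k = s n)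
include hL

theorem stage_spec (x : Node) {k : ℕ} (hk : stage m x ≤ k) :
    (x ∈ (m k).nodes ↔ x ∈ (union m).nodes) ∧ (m k).label x = (union m).label x ∧
    (m k).form x = (union m).form x := by
  have hne : {n | ∀ k, n ≤ k → (x ∈ (m k).nodes ↔ x ∈ (m n).nodes) ∧
      (m k).label x = (m n).label x ∧ (m k).form x = (m n).form x}.Nonempty := by
    obtain ⟨n, hn⟩ := hL _ (label_mono_of_chain hm hle x)
    by_cases hx : ∃ i, x ∈ (m i).nodes
    · obtain ⟨i, hi⟩ := hx
      refine ⟨max n i, fun k hk => ?_⟩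
      have h1 := (hle i _ (le_max_right n i)).subset hi
      refine ⟨⟨fun _ => h1, fun _ => (hle _ _ hk).subset h1⟩, ?_, ((hle _ _ hk).form_eq x h1).symm⟩
      exact (hn k ((le_max_left n i).trans hk)).trans (hn _ (le_max_left n i)).symm
    · push Not at hx
      exact ⟨n, fun k hk => ⟨by simp [hx], hn k hk,
        ((hm k).form_off x (hx k)).trans ((hm n).form_off x (hx n)).symm⟩⟩
  obtain ⟨h1, h2⟩ := Nat.sInf_mem hne k hk
  refine ⟨h1.trans ⟨fun h => Set.mem_iUnion.2 ⟨_, h⟩, fun h => ?_⟩, h2⟩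
  obtain ⟨i, hi⟩ := Set.mem_iUnion.1 h
  exact h1.1 (((Nat.sInf_mem hne _ (le_max_left k i |>.trans' hk)).1.trans h1.symm).1
    ((hle _ _ (le_max_right k i)).subset hi))

/-- The nodes up to a given level stop growing along a chain: once the labels below that level are
final, a new node would lie above a node that keeps its label `⊥`. -/
theorem exists_stage_of_lev (k : ℕ) :
    ∃ n, ∀ j, ∀ x ∈ (m j).nodes, (m j).lev x < k → x ∈ (m n).nodes := by
  induction k with
  | zero => exact ⟨0, fun _ _ _ h => absurd h (Nat.not_lt_zero _)⟩
  | succ k ih =>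
    obtain ⟨n, hn⟩ := ih
    have hfin : {x | x ∈ (m n).nodes ∧ (m n).lev x ≤ k}.Finite := (hm n).finite_level_le k
    obtain ⟨N, hN⟩ := (hfin.image (stage m)).bddAbove
    refine ⟨max n N, fun j x hx hlev => by_contra fun hxn => ?_⟩
    have hij := le_max_right j (max n N)
    set J := max j (max n N) with hJ
    have hji : (m j).Le (m J) := hle _ _ (le_max_left _ _)
    rcases ((hle _ _ hij).embVia (hm _) (hm _)).cover x (hji.subset hx) with
      ⟨_, h, rfl⟩ | ⟨b, hb, hbx⟩
    · exact hxn h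
    · have hbJ := (hle _ _ hij).subset hb.1
      have hlb : (m J).lev b < k := by
        have := (hm J).lev_lt_lev hbx
        rw [hji.lev_eq (hm j) (hm J) hx] at this
        omega
      have hbn := hn J b hbJ hlb
      have hbN : stage m b ≤ N := by
        refine hN ⟨b, ⟨hbn, ?_⟩, rfl⟩
        rw [← (hle n J ((le_max_left n N).trans hij)).lev_eq (hm n) (hm J) hbn]
        exact hlb.le
      refine (hm J).not_lt_of_mem_bots ⟨hbJ, ?_⟩ hbx
      rw [(stage_spec hm hle hL b (hbN.trans ((le_max_right n N).trans hij))).2.1,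
        ← (stage_spec hm hle hL b (hbN.trans (le_max_right n N))).2.1]
      exact hb.2

theorem isLPOF_union : (union m).IsLPOF := by
  have hmem : ∀ x ∈ (union m).nodes, ∃ n, x ∈ (m n).nodes ∧ (m n).label x = (union m).label x ∧
      (m n).form x = (union m).form x := fun x hx =>
    ⟨_, (stage_spec hm hle hL x le_rfl).1.2 hx, (stage_spec hm hle hL x le_rfl).2⟩
  have hform : ∀ n, ∀ x ∈ (m n).nodes, (union m).form x = (m n).form x := fun n x hx => by
    rw [(hle n _ (le_max_left n (stage m x))).form_eq x hx,
      (stage_spec hm hle hL x (le_max_right n _)).2.2]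
  have hpath : ∀ n x k, (m n).PathTo x k → (union m).PathTo x k := by
    rintro n x k ⟨c, h0, hk, hc⟩
    refine ⟨c, ⟨Set.mem_iUnion.2 ⟨n, h0.1⟩, (union_pred hm hle h0.1).trans h0.2⟩, hk,
      fun i hi => ?_⟩
    have h1 : c i ∈ (m n).pred (c (i + 1)) := hc i hi
    rw [← union_pred hm hle ((hm n).lt_mem _ _ h1.1).2] at h1
    exact h1
  have hirr : ∀ x, ¬ (union m).lt x x := fun x ⟨n, h⟩ => (hm n).irrefl x h
  have htr : ∀ x y z, (union m).lt x y → (union m).lt y z → (union m).lt x z := by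
    intro x y z h ⟨n, h'⟩
    have hy := ((hm n).lt_mem _ _ h').1
    exact ⟨n, (hm n).trans _ _ _ (union_down hm hle hy h) h'⟩
  have hbelow : ∀ x ∈ (union m).nodes, ((union m).below x).Finite := by
    intro x hx
    obtain ⟨n, hn, -⟩ := hmem x hx
    rw [union_below hm hle hn]
    exact (hm n).finite_below x hn
  refine ⟨?_, fun x hx => ?_, fun x hx => ?_, Set.countable_iUnion fun n => (hm n).countable,
    hirr, htr, hbelow, fun k => ?_, ?_, fun x hx hb => ?_, fun x hx => ?_, fun x hx => ?_,
    fun x y h => ?_⟩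
  · rintro x y ⟨n, h⟩
    exact ⟨Set.mem_iUnion.2 ⟨n, ((hm n).lt_mem _ _ h).1⟩,
      Set.mem_iUnion.2 ⟨n, ((hm n).lt_mem _ _ h).2⟩⟩
  · exact (hm _).label_off x fun h => hx (Set.mem_iUnion.2 ⟨_, h⟩)
  · exact (hm _).form_off x fun h => hx (Set.mem_iUnion.2 ⟨_, h⟩)
  · obtain ⟨n, hn⟩ := exists_stage_of_lev hm hle hL (k + 1)
    refine ((hm n).finite_level_le k).subset ?_
    rintro x ⟨hx, hk⟩
    have hlev : ∀ j, x ∈ (m j).nodes → (m j).lev x ≤ k := fun j hj => by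
      rw [← hk]
      exact lev_le_lev hirr htr (hbelow x hx) fun i hi => ⟨i, le_rfl, hpath j x i hi⟩
    obtain ⟨j, hj, -⟩ := hmem x hx
    have hxn := hn j x hj (Nat.lt_succ_of_le (hlev j hj))
    exact ⟨hxn, hlev n hxn⟩
  · obtain ⟨r, hr, -⟩ := (hm 0).single_root
    have hr' : r ∈ (union m).mins :=
      ⟨Set.mem_iUnion.2 ⟨0, hr.1⟩, (union_pred hm hle hr.1).trans hr.2⟩
    refine ⟨r, hr', fun x hx => ?_⟩
    obtain ⟨n, hn, -⟩ := hmem x hx.1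
    have hrn := (hle 0 n (Nat.zero_le n)).subset hr.1
    exact (hm n).single_root.unique ⟨hn, (union_pred hm hle hn).symm.trans hx.2⟩
      ⟨hrn, (union_pred hm hle hrn).symm.trans hr'.2⟩
  · refine Set.eq_empty_of_forall_notMem fun y hy => ?_
    obtain ⟨n, hn, hxy⟩ := exists_ge_lt_of_union_lt hm hle hy.1 (stage m x)
    refine (hm n).not_lt_of_mem_bots ⟨((hm n).lt_mem _ _ hxy).1, ?_⟩ hxy
    rw [(stage_spec hm hle hL x hn).2.1, hb]
  · obtain ⟨n, hn, -, hf⟩ := hmem x hx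
    rw [← hf]
    exact (hm n).form_sat x hn
  · obtain ⟨n, hn, -, hf⟩ := hmem x hx
    rw [← hf, union_below hm hle hn]
    exact (hm n).form_free x hn
  · obtain ⟨n, h⟩ := h
    rw [hform n x ((hm n).lt_mem _ _ h).1, hform n y ((hm n).lt_mem _ _ h).2]
    exact (hm n).form_entails x y h

theorem le_union (n : ℕ) : (m n).Le (union m) := by
  have hU := isLPOF_union hm hle hL
  refine EmbVia.le (hm n) hU ⟨fun x hx => Set.mem_iUnion.2 ⟨n, hx⟩, Set.injOn_id _,
    fun x hx y hy => union_lt_iff hm hle hx hy, fun x hx y hy => ?_, fun x hx => ?_,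
    fun x hx => ?_, fun y hy => ?_⟩
  · exact ⟨y, ((hm n).lt_mem _ _ (union_down hm hle hx hy)).1, rfl⟩
  · rw [← (stage_spec hm hle hL x (le_max_right n _)).2.1]
    exact label_mono_of_chain hm hle x (le_max_left n (stage m x))
  · rw [Form.rename_id, (hle n _ (le_max_left n (stage m x))).form_eq x hx,
      (stage_spec hm hle hL x (le_max_right n _)).2.2]
  · have hy' := (stage_spec hm hle hL y (le_max_right n _)).1.2 hy
    refine (((hle n _ (le_max_left n _)).embVia (hm _) (hm _)).cover y hy').imp_right ?_
    rintro ⟨b, hb, hby⟩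
    exact ⟨b, hb, _, hby⟩

/-- Finite structures are compact with respect to unions of chains. -/
theorem exists_le_of_le_union (hα : α.IsLPOF) (hf : α.nodes.Finite) (h : α.Le (union m)) :
    ∃ n, α.Le (m n) := by
  obtain ⟨n, hn⟩ := (hf.image (stage m)).bddAbove
  have hst : ∀ x ∈ α.nodes, stage m x ≤ n := fun x hx => hn ⟨x, hx, rfl⟩
  refine ⟨n, Le.of_le_of_le hα (hm n) (isLPOF_union hm hle hL) h (le_union hm hle hL n)
    (fun x hx => ?_) fun x hx => ?_⟩
  · exact (stage_spec hm hle hL x (hst x hx)).1.2 (h.subset hx)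
  · rw [(stage_spec hm hle hL x (hst x hx)).2.1]
    exact h.label_le x hx

end chain

/-! ### Renaming and embeddings -/

theorem EmbVia.image_le (hα : α.IsLPOF) (hβ : β.IsLPOF) {f : Node → Node} (h : EmbVia f α β) :
    (α.image f).Le β := by
  have hiso := isoVia_image hα h.injOn
  refine EmbVia.le (hα.image h.injOn) hβ ⟨h.mapsTo.image_subset, Set.injOn_id _, ?_, ?_, ?_, ?_,
    fun y hy => ?_⟩
  · rintro _ ⟨a, ha, rfl⟩ _ ⟨b, hb, rfl⟩
    rw [h.lt_iff a ha b hb, hiso.lt_iff a ha b hb]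
  · rintro _ ⟨a, ha, rfl⟩ y hy
    exact ⟨y, h.down a ha y hy, rfl⟩
  · rintro _ ⟨a, ha, rfl⟩
    rw [image_label h.injOn ha]
    exact h.label_le a ha
  · rintro _ ⟨a, ha, rfl⟩
    rw [Form.rename_id, image_form h.injOn ha, h.form_eq a ha]
  · refine (h.cover y hy).imp (fun hh => ⟨y, hh, rfl⟩) ?_
    rintro ⟨b, hb, hby⟩
    exact ⟨f b, ⟨⟨b, hb.1, rfl⟩, (image_label h.injOn hb.1).trans hb.2⟩, hby⟩

theorem IsoVia.trunc (hα : α.IsLPOF) (hβ : β.IsLPOF) {f : Node → Node} (h : IsoVia f α β) (n : ℕ) :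
    IsoVia f (α.trunc n) (β.trunc n) := by
  have hlev := (h.embVia hβ).lev_eq hα hβ
  have hmaps : ∀ x ∈ (α.trunc n).nodes, f x ∈ (β.trunc n).nodes := fun x hx =>
    ⟨h.bij.mapsTo hx.1, (hlev x hx.1).le.trans hx.2⟩
  refine ⟨⟨hmaps, h.bij.injOn.mono fun x hx => hx.1, ?_⟩, fun x hx y hy => ?_, fun x hx => ?_,
    fun x hx => ?_⟩
  · rintro y ⟨hy, hyn⟩
    obtain ⟨x, hx, rfl⟩ := h.bij.surjOn hy
    exact ⟨x, ⟨hx, (hlev x hx).ge.trans hyn⟩, rfl⟩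
  · exact and_congr (h.lt_iff x hx.1 y hy.1) (by rw [hlev y hy.1])
  · simp only [PreLPOF.trunc, hlev x hx.1, h.label_eq x hx.1]
  · rw [trunc_form hx, trunc_form (hmaps x hx), h.form_eq x hx.1]

/-! ### Guarded choice on structures -/

theorem Le.guard {α' β' : PreLPOF Node L} (hα : α.IsLPOF) (hβ : β.IsLPOF) (hα' : α'.IsLPOF)
    (hβ' : β'.IsLPOF) (h : α.Le α') (h' : β.Le β') {x : Node} {ℓ : L} (hℓ : ℓ ≠ ⊥)
    (hd : Disjoint α'.nodes β'.nodes) (hxα : x ∉ α'.nodes) (hxβ : x ∉ β'.nodes) :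
    (PreLPOF.guard x ℓ α β).Le (PreLPOF.guard x ℓ α' β') := by
  classical
  have e := h.embVia hα hα'
  have e' := h'.embVia hβ hβ'
  have mX : ∀ y ∈ α.nodes, y ≠ x := fun y hy hh => hxα (hh ▸ h.subset hy)
  have mX' : ∀ y ∈ β.nodes, y ≠ x := fun y hy hh => hxβ (hh ▸ h'.subset hy)
  have hdβ : ∀ y ∈ β.nodes, y ∉ α.nodes := fun y hy hy' =>
    Set.disjoint_left.1 hd (h.subset hy') (h'.subset hy)
  have mA : ∀ y ∈ (PreLPOF.guard x ℓ α β).nodes, (y ∈ α'.nodes ↔ y ∈ α.nodes) := by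
    rintro y ((rfl | hy) | hy)
    · exact ⟨fun hh => absurd hh hxα, fun hh => h.subset hh⟩
    · exact ⟨fun _ => hy, fun hh => h.subset hh⟩
    · exact ⟨fun hh => absurd (h'.subset hy) (Set.disjoint_left.1 hd hh), fun hh => h.subset hh⟩
  have mB : ∀ y ∈ (PreLPOF.guard x ℓ α β).nodes, (y ∈ β'.nodes ↔ y ∈ β.nodes) := by
    rintro y ((rfl | hy) | hy)
    · exact ⟨fun hh => absurd hh hxβ, fun hh => h'.subset hh⟩
    · exact ⟨fun hh => absurd hh (Set.disjoint_left.1 hd (h.subset hy)), fun hh => h'.subset hh⟩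
    · exact ⟨fun _ => hy, fun hh => h'.subset hh⟩
  refine EmbVia.le (isLPOF_guard hα hβ hℓ (hd.mono h.subset h'.subset) (fun hh => hxα (h.subset hh))
    fun hh => hxβ (h'.subset hh)) (isLPOF_guard hα' hβ' hℓ hd hxα hxβ)
    ⟨?_, Set.injOn_id _, fun y hy z hz => ?_, fun y hy z hz => ?_, fun y hy => ?_, fun y hy => ?_,
      fun y hy => ?_⟩
  · rintro y ((hy | hy) | hy)
    exacts [Or.inl (Or.inl hy), Or.inl (Or.inr (h.subset hy)), Or.inr (h'.subset hy)]
  · refine or_congr ⟨fun hh => ?_, fun hh => ((h.lt_iff y z).1 hh).1⟩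
      (or_congr ⟨fun hh => ?_, fun hh => ((h'.lt_iff y z).1 hh).1⟩
        (and_congr_right' (or_congr (mA z hz) (mB z hz))))
    · have := hα'.lt_mem _ _ hh
      exact (h.lt_iff y z).2 ⟨hh, (mA y hy).1 this.1, (mA z hz).1 this.2⟩
    · have := hβ'.lt_mem _ _ hh
      exact (h'.lt_iff y z).2 ⟨hh, (mB y hy).1 this.1, (mB z hz).1 this.2⟩
  · refine ⟨z, ?_, rfl⟩
    rcases hz with hz | hz | ⟨rfl, -⟩
    · exact Or.inl (Or.inr (h.down y ((mA y hy).1 (hα'.lt_mem _ _ hz).2) hz))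
    · exact Or.inr (h'.down y ((mB y hy).1 (hβ'.lt_mem _ _ hz).2) hz)
    · exact Or.inl (Or.inl rfl)
  · simp only [PreLPOF.guard, mA y hy, mB y hy]
    split_ifs with h1 h2 h3
    · exact le_rfl
    · exact h.label_le y h2
    · exact h'.label_le y h3
    · exact le_rfl
  · rw [Form.rename_id]
    simp only [PreLPOF.guard, mA y hy, mB y hy]
    split_ifs with h1 h2 h3
    · rfl
    · rw [h.form_eq y h2]
    · rw [h'.form_eq y h3]
    · rfl
  · rcases hy with (hy | hy) | hy
    · exact Or.inl ⟨y, Or.inl (Or.inl hy), rfl⟩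
    · rcases e.cover y hy with ⟨z, hz, rfl⟩ | ⟨b, hb, hby⟩
      · exact Or.inl ⟨z, Or.inl (Or.inr hz), rfl⟩
      · refine Or.inr ⟨b, ⟨Or.inl (Or.inr hb.1), ?_⟩, Or.inl hby⟩
        simp only [PreLPOF.guard, if_neg (mX b hb.1), if_pos hb.1, hb.2]
    · rcases e'.cover y hy with ⟨z, hz, rfl⟩ | ⟨b, hb, hby⟩
      · exact Or.inl ⟨z, Or.inr hz, rfl⟩
      · refine Or.inr ⟨b, ⟨Or.inr hb.1, ?_⟩, Or.inr (Or.inl hby)⟩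
        simp only [PreLPOF.guard, if_neg (mX' b hb.1), if_neg (hdβ b hb.1), if_pos hb.1, hb.2]

theorem single_bot_le_guard (hα : α.IsLPOF) (hβ : β.IsLPOF) {x : Node} {ℓ : L} (hℓ : ℓ ≠ ⊥)
    (hd : Disjoint α.nodes β.nodes) (hxα : x ∉ α.nodes) (hxβ : x ∉ β.nodes) :
    (single x (⊥ : L)).Le (PreLPOF.guard x ℓ α β) := by
  have hG := isLPOF_guard hα hβ hℓ hd hxα hxβ
  have hx : ∀ y, ¬ (PreLPOF.guard x ℓ α β).lt y x := by
    rintro y (h | h | ⟨-, h | h⟩)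
    exacts [hxα (hα.lt_mem _ _ h).2, hxβ (hβ.lt_mem _ _ h).2, hxα h, hxβ h]
  have hlab : ∀ y, (single x (⊥ : L)).label y = ⊥ := fun y => by simp [single]
  refine EmbVia.le (isLPOF_single x ⊥) hG ⟨fun y hy => Or.inl (Or.inl hy), Set.injOn_id _, ?_, ?_,
    fun y _ => (hlab y).le.trans bot_le, ?_, fun y hy => ?_⟩
  · rintro y - z rfl
    exact ⟨fun h => (hx y h).elim, fun h => h.elim⟩
  · rintro y rfl z hz
    exact (hx z hz).elim
  · rintro y rfl
    exact if_pos rfl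
  · rcases hy with (hy | hy) | hy
    · exact Or.inl ⟨y, hy, rfl⟩
    · exact Or.inr ⟨x, ⟨rfl, hlab x⟩, Or.inr (Or.inr ⟨rfl, Or.inl hy⟩)⟩
    · exact Or.inr ⟨x, ⟨rfl, hlab x⟩, Or.inr (Or.inr ⟨rfl, Or.inr hy⟩)⟩

end PreLPOF

namespace LPOF

variable {Node : Type u} {L : Type v} [PartialOrder L] [OrderBot L]

/-- The part of `α` up to level `n`, with the labels at level `n` forgotten. -/
noncomputable def trunc (n : ℕ) (α : LPOF Node L) : LPOF Node L where
  toPreLPOF := α.toPreLPOF.trunc n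
  isLPOF := α.isLPOF.trunc n

/-- If `α` embeds in `β` and leaves infinitely many nodes unused, then `α` itself is at most some
renaming of `β`. -/
theorem exists_iso_le_of_embVia {α β : LPOF Node L} {f : Node → Node}
    (h : PreLPOF.EmbVia f α.toPreLPOF β.toPreLPOF) (hS : α.nodesᶜ.Infinite) :
    ∃ γ, Iso β γ ∧ α ≤ γ := by
  classical
  obtain ⟨e, he⟩ := Set.countable_iff_exists_injOn.1 β.isLPOF.countable
  have : Infinite ↥(α.nodesᶜ) := hS.to_subtype
  have : Nonempty Node := ⟨hS.nonempty.some⟩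
  let i := Infinite.natEmbedding ↥(α.nodesᶜ)
  let g : Node → Node := fun y =>
    if y ∈ f '' α.nodes then Function.invFunOn f α.nodes y else (i (e y) : Node)
  have hgf : ∀ x ∈ α.nodes, g (f x) = x := fun x hx => by
    simp only [g, if_pos (Set.mem_image_of_mem f hx)]
    exact h.injOn.leftInvOn_invFunOn hx
  have hgn : ∀ y, y ∉ f '' α.nodes → g y = (i (e y) : Node) := fun y hy => if_neg hy
  have hg : Set.InjOn g β.nodes := by
    intro y hy z hz hyz
    by_cases h1 : y ∈ f '' α.nodes <;> by_cases h2 : z ∈ f '' α.nodes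
    · obtain ⟨a, ha, rfl⟩ := h1
      obtain ⟨b, hb, rfl⟩ := h2
      rw [hgf a ha, hgf b hb] at hyz
      rw [hyz]
    · obtain ⟨a, ha, rfl⟩ := h1
      rw [hgf a ha, hgn z h2] at hyz
      exact absurd ha (hyz ▸ (i (e z)).2)
    · obtain ⟨b, hb, rfl⟩ := h2
      rw [hgf b hb, hgn y h1] at hyz
      exact absurd hb (hyz ▸ (i (e y)).2)
    · rw [hgn y h1, hgn z h2] at hyz
      exact he hy hz (i.injective (Subtype.ext hyz))
  refine ⟨β.image g hg, iso_image _ _ _, ?_⟩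
  have h1 := h.trans (β.image g hg).isLPOF
    ((PreLPOF.isoVia_image β.isLPOF hg).embVia (β.image g hg).isLPOF)
  exact (h1.congr α.isLPOF hgf).le α.isLPOF (β.image g hg).isLPOF

end LPOF

namespace Pom

variable {Node : Type u} {L : Type v} [PartialOrder L] [OrderBot L]

/-! ### The order of pomsets in terms of representatives -/

theorem mem_mk (α : LPOF Node L) : α ∈ mk α := LPOF.Iso.refl α

theorem le_of_embVia {A B : Pom Node L} {α β : LPOF Node L} (hα : α ∈ A) (hβ : β ∈ B)
    {f : Node → Node} (h : PreLPOF.EmbVia f α.toPreLPOF β.toPreLPOF) : A ≤ B := by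
  intro γ hγ
  obtain ⟨g, hg⟩ := (mem_iff_iso hβ).1 hγ
  have h1 := h.trans γ.isLPOF (hg.embVia γ.isLPOF)
  exact ⟨α.image _ h1.injOn, (mem_iff_iso hα).2 (LPOF.iso_image _ _ _),
    h1.image_le α.isLPOF γ.isLPOF⟩

theorem le_of_mem_of_le {A B : Pom Node L} {α β : LPOF Node L} (hα : α ∈ A) (hβ : β ∈ B)
    (h : α ≤ β) : A ≤ B :=
  le_of_embVia hα hβ (PreLPOF.Le.embVia α.isLPOF β.isLPOF h)

theorem exists_embVia {A B : Pom Node L} (h : A ≤ B) {α β : LPOF Node L} (hα : α ∈ A)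
    (hβ : β ∈ B) : ∃ f, PreLPOF.EmbVia f α.toPreLPOF β.toPreLPOF := by
  obtain ⟨γ, hγ, hle⟩ := h β hβ
  obtain ⟨g, hg⟩ := (mem_iff_iso hα).1 hγ
  exact ⟨_, (hg.embVia γ.isLPOF).trans β.isLPOF (PreLPOF.Le.embVia γ.isLPOF β.isLPOF hle)⟩

theorem isFinite_of_mem {A : Pom Node L} {α : LPOF Node L} (hα : α ∈ A) (hf : α.nodes.Finite) :
    A.IsFinite := by
  intro β hβ
  obtain ⟨g, hg⟩ := (mem_iff_iso hα).1 hβ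
  rw [← hg.bij.image_eq]
  exact hf.image g

/-- An ascending sequence of finite pomsets has representatives that form an ascending sequence. -/
theorem exists_chain [Infinite Node] {A : ℕ → Pom Node L} (hA : ∀ n, (A n).IsFinite)
    (hmono : ∀ n, A n ≤ A (n + 1)) : ∃ m : ℕ → LPOF Node L, (∀ n, m n ∈ A n) ∧ Monotone m := by
  have step : ∀ n (α : {α // α ∈ A n}), ∃ β : {β // β ∈ A (n + 1)}, α.1 ≤ β.1 := by
    rintro n ⟨α, hα⟩
    obtain ⟨β, hβ⟩ := (A (n + 1)).exists_mem
    obtain ⟨f, hf⟩ := exists_embVia (hmono n) hα hβ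
    obtain ⟨γ, hγ, hle⟩ := LPOF.exists_iso_le_of_embVia hf (hA n α hα).infinite_compl
    exact ⟨⟨γ, (mem_iff_iso hβ).2 hγ⟩, hle⟩
  choose next hnext using step
  obtain ⟨α, hα⟩ := (A 0).exists_mem
  let m : ∀ n, {α // α ∈ A n} := fun n => Nat.rec ⟨α, hα⟩ next n
  exact ⟨fun n => (m n).1, fun n => (m n).2, monotone_nat_of_le_succ fun n => hnext n (m n)⟩

/-! ### Truncation of pomsets -/

/-- The part of a pomset up to level `n`, with the labels at level `n` forgotten. -/
noncomputable def trunc (n : ℕ) (A : Pom Node L) : Pom Node L := mk (A.exists_mem.choose.trunc n)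

theorem trunc_mem_trunc {A : Pom Node L} {α : LPOF Node L} (hα : α ∈ A) (n : ℕ) :
    α.trunc n ∈ A.trunc n := by
  obtain ⟨f, hf⟩ := (mem_iff_iso A.exists_mem.choose_spec).1 hα
  exact ⟨f, hf.trunc (LPOF.isLPOF _) α.isLPOF n⟩

theorem isFinite_trunc (n : ℕ) (A : Pom Node L) : (A.trunc n).IsFinite := by
  obtain ⟨α, hα⟩ := A.exists_mem
  exact isFinite_of_mem (trunc_mem_trunc hα n) (α.isLPOF.trunc_nodes_finite n)

theorem trunc_le (n : ℕ) (A : Pom Node L) : A.trunc n ≤ A := by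
  obtain ⟨α, hα⟩ := A.exists_mem
  exact le_of_mem_of_le (trunc_mem_trunc hα n) hα (α.isLPOF.trunc_le n)

theorem trunc_mono {A B : Pom Node L} (h : A ≤ B) {m n : ℕ} (hmn : m ≤ n) :
    A.trunc m ≤ B.trunc n := by
  obtain ⟨β, hβ⟩ := B.exists_mem
  obtain ⟨α, hα, hle⟩ := h β hβ
  exact le_of_mem_of_le (trunc_mem_trunc hα m) (trunc_mem_trunc hβ n)
    (PreLPOF.Le.trunc_mono α.isLPOF β.isLPOF hle hmn)

theorem lev_le_of_mem_trunc {A : Pom Node L} {n : ℕ} {τ : LPOF Node L} (hτ : τ ∈ A.trunc n) :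
    ∀ x ∈ τ.nodes, τ.lev x ≤ n := by
  intro x hx
  obtain ⟨α, hα⟩ := A.exists_mem
  obtain ⟨f, hf⟩ := (mem_iff_iso (trunc_mem_trunc hα n)).1 hτ
  obtain ⟨y, hy, rfl⟩ := hf.bij.surjOn hx
  rw [(hf.embVia τ.isLPOF).lev_eq (LPOF.isLPOF _) τ.isLPOF y hy,
    ← PreLPOF.Le.lev_eq (LPOF.isLPOF _) α.isLPOF (α.isLPOF.trunc_le n) hy]
  exact hy.2

theorem le_of_forall_trunc_le {A B : Pom Node L} (h : ∀ n, A.trunc n ≤ B) : A ≤ B := by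
  obtain ⟨α, hα⟩ := A.exists_mem
  obtain ⟨β, hβ⟩ := B.exists_mem
  obtain ⟨f, hf⟩ := PreLPOF.exists_embVia_of_trunc α.isLPOF β.isLPOF fun n =>
    exists_embVia (h n) (trunc_mem_trunc hα n) hβ
  exact le_of_embVia hα hβ hf

theorem exists_le_trunc {A K : Pom Node L} (hK : K.IsFinite) (h : K ≤ A) :
    ∃ n, ∀ m, n ≤ m → K ≤ A.trunc m := by
  obtain ⟨α, hα⟩ := A.exists_mem
  obtain ⟨κ, hκ, hle⟩ := h α hα
  obtain ⟨n, hn⟩ := PreLPOF.Le.exists_le_trunc κ.isLPOF α.isLPOF hle (hK κ hκ)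
  exact ⟨n, fun m hm => le_of_mem_of_le hκ (trunc_mem_trunc hα m) (hn m hm)⟩

theorem finApprox_nonempty (A : Pom Node L) : A.finApprox.Nonempty :=
  ⟨A.trunc 0, isFinite_trunc 0 A, trunc_le 0 A⟩

theorem directedOn_finApprox (A : Pom Node L) : DirectedOn (· ≤ ·) A.finApprox := by
  rintro K ⟨hK, hKA⟩ K' ⟨hK', hKA'⟩
  obtain ⟨n, hn⟩ := exists_le_trunc hK hKA
  obtain ⟨n', hn'⟩ := exists_le_trunc hK' hKA'
  exact ⟨A.trunc (max n n'), ⟨isFinite_trunc _ A, trunc_le _ A⟩, hn _ (le_max_left _ _),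
    hn' _ (le_max_right _ _)⟩

/-! ### Suprema of directed sets -/

section dcpo

variable [Infinite Node] (hL : ∀ s : ℕ → L, Monotone s → ∃ n, ∀ k, n ≤ k → s k = s n)
include hL

/-- Below a fixed level, a directed set of pomsets has a greatest element: otherwise there would be
a strictly ascending chain of structures of bounded level; its union has bounded level as well, so
it is finite and hence below a member of the chain. -/
theorem exists_greatest_trunc {D : Set (Pom Node L)} (hne : D.Nonempty)
    (hD : DirectedOn (· ≤ ·) D) (n : ℕ) : ∃ P ∈ D, ∀ Q ∈ D, Q.trunc n ≤ P.trunc n := by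
  suffices H : ∃ P ∈ D, ∀ Q ∈ D, P ≤ Q → Q.trunc n ≤ P.trunc n by
    obtain ⟨P, hP, hmax⟩ := H
    refine ⟨P, hP, fun Q hQ => ?_⟩
    obtain ⟨R, hR, hPR, hQR⟩ := hD P hP Q hQ
    exact (trunc_mono hQR le_rfl).trans (hmax R hR hPR)
  by_contra! hcon
  have step : ∀ P : D, ∃ Q : D, P.1 ≤ Q.1 ∧ ¬ Q.1.trunc n ≤ P.1.trunc n := fun P =>
    let ⟨Q, hQ, h⟩ := hcon P.1 P.2
    ⟨⟨Q, hQ⟩, h⟩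
  choose next hle hnot using step
  let P : ℕ → D := fun i => next^[i] ⟨hne.some, hne.some_mem⟩
  have hP : ∀ i, P (i + 1) = next (P i) := fun i => Function.iterate_succ_apply' next i _
  obtain ⟨m, hm, hmono⟩ := exists_chain (A := fun i => (P i).1.trunc n)
    (fun i => isFinite_trunc n _) fun i => trunc_mono (hP i ▸ hle (P i)) le_rfl
  have hmL : ∀ i, (m i).toPreLPOF.IsLPOF := fun i => (m i).isLPOF
  have hmle : ∀ i j, i ≤ j → (m i).toPreLPOF.Le (m j).toPreLPOF := fun i j hij => hmono hij
  have hU := PreLPOF.isLPOF_union hmL hmle hL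
  have hUle := PreLPOF.le_union hmL hmle hL
  have hfin : (PreLPOF.union fun i => (m i).toPreLPOF).nodes.Finite := by
    refine (hU.finite_level_le n).subset fun x hx => ⟨hx, ?_⟩
    obtain ⟨i, hi⟩ := Set.mem_iUnion.1 hx
    rw [(hUle i).lev_eq (hmL i) hU hi]
    exact lev_le_of_mem_trunc (hm i) x hi
  obtain ⟨i, hi⟩ := PreLPOF.exists_le_of_le_union hmL hmle hL hU hfin (PreLPOF.Le.refl hU)
  refine hnot (P i) ?_
  rw [← hP]
  exact le_of_mem_of_le (hm (i + 1)) (hm i)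
    (PreLPOF.Le.trans (hmL _) hU (hmL i) (hUle (i + 1)) hi)

/-- A nonempty directed set of pomsets has a supremum, and every finite pomset below the supremum is
below a member of the set. -/
theorem exists_isLUB_of_directedOn {D : Set (Pom Node L)} (hne : D.Nonempty)
    (hD : DirectedOn (· ≤ ·) D) :
    ∃ P, IsLUB D P ∧ ∀ K : Pom Node L, K.IsFinite → K ≤ P → ∃ Q ∈ D, K ≤ Q := by
  choose P hP hmax using exists_greatest_trunc hL hne hD
  obtain ⟨m, hm, hmono⟩ := exists_chain (A := fun n => (P n).trunc n)
    (fun n => isFinite_trunc n _) fun n =>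
      (trunc_mono le_rfl (Nat.le_succ n)).trans (hmax (n + 1) (P n) (hP n))
  have hmL : ∀ i, (m i).toPreLPOF.IsLPOF := fun i => (m i).isLPOF
  have hmle : ∀ i j, i ≤ j → (m i).toPreLPOF.Le (m j).toPreLPOF := fun i j hij => hmono hij
  let U : LPOF Node L := ⟨_, PreLPOF.isLPOF_union hmL hmle hL⟩
  have hcompact : ∀ K : Pom Node L, K.IsFinite → K ≤ mk U → ∃ Q ∈ D, K ≤ Q := by
    intro K hK hKU
    obtain ⟨κ, hκ, hle⟩ := hKU U (mem_mk U)
    obtain ⟨n, hn⟩ := PreLPOF.exists_le_of_le_union hmL hmle hL κ.isLPOF (hK κ hκ) hle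
    exact ⟨P n, hP n, (le_of_mem_of_le hκ (hm n) hn).trans (trunc_le n _)⟩
  refine ⟨mk U, ⟨fun Q hQ => ?_, fun R hR => ?_⟩, hcompact⟩
  · exact le_of_forall_trunc_le fun n => (hmax n Q hQ).trans
      (le_of_mem_of_le (hm n) (mem_mk U) (PreLPOF.le_union hmL hmle hL n))
  · refine le_of_forall_trunc_le fun n => ?_
    obtain ⟨Q, hQ, hle⟩ := hcompact _ (isFinite_trunc n _) (trunc_le n _)
    exact hle.trans (hR hQ)

/-- Finite pomsets are compact elements of the dcpo of pomsets. -/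
theorem exists_le_of_isFinite_of_isLUB {D : Set (Pom Node L)} (hne : D.Nonempty)
    (hD : DirectedOn (· ≤ ·) D) {P K : Pom Node L} (hP : IsLUB D P) (hK : K.IsFinite)
    (h : K ≤ P) : ∃ Q ∈ D, K ≤ Q := by
  obtain ⟨P', hP', hc⟩ := exists_isLUB_of_directedOn hL hne hD
  exact hc K hK (hP.unique hP' ▸ h)

end dcpo

/-! ### Guarded choice on pomsets -/

section guard

variable [Infinite Node] {ℓ : L} (hℓ : ℓ ≠ ⊥)

theorem guardFin_mono {A A' B B' : {A : Pom Node L // A.IsFinite}} (hA : A.1 ≤ A'.1)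
    (hB : B.1 ≤ B'.1) : guardFin ℓ hℓ A B ≤ guardFin ℓ hℓ A' B' := by
  rintro _ ⟨x, α', β', hd, hx, hα', hβ', rfl⟩
  obtain ⟨α, hα, hle⟩ := hA α' hα'
  obtain ⟨β, hβ, hle'⟩ := hB β' hβ'
  have hs : α.nodes ⊆ α'.nodes := PreLPOF.Le.subset hle
  have hs' : β.nodes ⊆ β'.nodes := PreLPOF.Le.subset hle'
  have hx1 : x ∉ α'.nodes := fun h => hx (Or.inl h)
  have hx2 : x ∉ β'.nodes := fun h => hx (Or.inr h)
  exact ⟨LPOF.guard x ℓ hℓ α β (hd.mono hs hs') fun h => hx (h.imp (@hs x) (@hs' x)),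
    ⟨x, α, β, _, _, hα, hβ, rfl⟩,
    PreLPOF.Le.guard α.isLPOF β.isLPOF α'.isLPOF β'.isLPOF hle hle' hℓ hd hx1 hx2⟩

/-- A pomset is above `⟨⊥⟩` only if the formula at its root is literally `true`, which holds for
guarded choices; so `⟨⊥⟩` need not be a least element. -/
theorem singleton_bot_le_guardFin (A B : {A : Pom Node L // A.IsFinite}) :
    singleton ⊥ ≤ guardFin ℓ hℓ A B := by
  rintro _ ⟨x, α, β, hd, hx, -, -, rfl⟩
  refine ⟨LPOF.single x ⊥, ⟨fun _ => x, ?_⟩, PreLPOF.single_bot_le_guard α.isLPOF β.isLPOF hℓ hd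
    (fun h => hx (Or.inl h)) fun h => hx (Or.inr h)⟩
  refine ⟨⟨fun _ _ => rfl, fun y hy z hz _ => hy.trans hz.symm, ?_⟩, fun _ _ _ _ => Iff.rfl,
    fun y _ => ?_, fun _ _ => rfl⟩
  · rintro y rfl
    exact ⟨_, rfl, rfl⟩
  · simp [LPOF.single, PreLPOF.single]

variable (hL : ∀ s : ℕ → L, Monotone s → ∃ n, ∀ k, n ≤ k → s k = s n)

theorem isLUB_sup {S : Set (Pom Node L)} (h : ∃ P, IsLUB S P) : IsLUB S (sup S) := by
  rw [sup, dif_pos h]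
  exact h.choose_spec

include hL

theorem isLUB_guardInner (A' : {A : Pom Node L // A.IsFinite}) (B : Pom Node L) :
    IsLUB (guardInner ℓ hℓ A' B) (sup (guardInner ℓ hℓ A' B)) := by
  refine isLUB_sup ((exists_isLUB_of_directedOn hL ?_ ?_).imp fun _ h => h.1)
  · obtain ⟨K, hK⟩ := B.finApprox_nonempty
    exact ⟨_, ⟨K, hK.1⟩, hK, rfl⟩
  · rintro _ ⟨K, hK, rfl⟩ _ ⟨K', hK', rfl⟩
    obtain ⟨M, hM, h, h'⟩ := B.directedOn_finApprox K.1 hK K'.1 hK'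
    exact ⟨_, ⟨⟨M, hM.1⟩, hM, rfl⟩, guardFin_mono hℓ le_rfl h, guardFin_mono hℓ le_rfl h'⟩

theorem sup_guardInner_mono {A A' : {A : Pom Node L // A.IsFinite}} (h : A.1 ≤ A'.1)
    (B : Pom Node L) : sup (guardInner ℓ hℓ A B) ≤ sup (guardInner ℓ hℓ A' B) := by
  refine (isLUB_guardInner hℓ hL A B).2 ?_
  rintro _ ⟨K, hK, rfl⟩
  exact (guardFin_mono hℓ h le_rfl).trans ((isLUB_guardInner hℓ hL A' B).1 ⟨K, hK, rfl⟩)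

theorem isLUB_guardOuter (A B : Pom Node L) : IsLUB (guardOuter ℓ hℓ A B) (guard ℓ hℓ A B) := by
  refine isLUB_sup ((exists_isLUB_of_directedOn hL ?_ ?_).imp fun _ h => h.1)
  · obtain ⟨K, hK⟩ := A.finApprox_nonempty
    exact ⟨_, ⟨K, hK.1⟩, hK, rfl⟩
  · rintro _ ⟨K, hK, rfl⟩ _ ⟨K', hK', rfl⟩
    obtain ⟨M, hM, h, h'⟩ := A.directedOn_finApprox K.1 hK K'.1 hK'
    exact ⟨_, ⟨⟨M, hM.1⟩, hM, rfl⟩, sup_guardInner_mono (A' := ⟨M, hM.1⟩) hℓ hL h B,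
      sup_guardInner_mono (A' := ⟨M, hM.1⟩) hℓ hL h' B⟩

/-- The iterated supremum that defines guarded choice is a supremum over pairs of finite
approximations. -/
theorem guard_le_iff {A B Q : Pom Node L} :
    guard ℓ hℓ A B ≤ Q ↔ ∀ A' B' : {A : Pom Node L // A.IsFinite}, A'.1 ≤ A → B'.1 ≤ B →
      guardFin ℓ hℓ A' B' ≤ Q := by
  constructor
  · intro h A' B' hA hB
    exact ((isLUB_guardInner hℓ hL A' B).1 ⟨B', ⟨B'.2, hB⟩, rfl⟩).trans
      (((isLUB_guardOuter hℓ hL A B).1 ⟨A', ⟨A'.2, hA⟩, rfl⟩).trans h)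
  · intro h
    refine (isLUB_guardOuter hℓ hL A B).2 ?_
    rintro _ ⟨A', hA, rfl⟩
    refine (isLUB_guardInner hℓ hL A' B).2 ?_
    rintro _ ⟨B', hB, rfl⟩
    exact h A' B' hA.2 hB.2

theorem guardFin_le_guard {A B : Pom Node L} {A' B' : {A : Pom Node L // A.IsFinite}}
    (hA : A'.1 ≤ A) (hB : B'.1 ≤ B) : guardFin ℓ hℓ A' B' ≤ guard ℓ hℓ A B :=
  (guard_le_iff hℓ hL).1 le_rfl A' B' hA hB

theorem guard_eq_guardFin (A B : {A : Pom Node L // A.IsFinite}) :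
    guard ℓ hℓ A.1 B.1 = guardFin ℓ hℓ A B :=
  ((guard_le_iff hℓ hL).2 fun _ _ hA hB => guardFin_mono hℓ hA hB).antisymm
    (guardFin_le_guard hℓ hL le_rfl le_rfl)

theorem singleton_bot_le_guard (A B : Pom Node L) : singleton ⊥ ≤ guard ℓ hℓ A B :=
  (singleton_bot_le_guardFin hℓ ⟨_, isFinite_trunc 0 A⟩ ⟨_, isFinite_trunc 0 B⟩).trans
    (guardFin_le_guard hℓ hL (trunc_le 0 A) (trunc_le 0 B))

theorem scottContinuous_guard :
    ScottContinuous fun p : Pom Node L × Pom Node L => guard ℓ hℓ p.1 p.2 := by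
  rintro d hne hd ⟨A, B⟩ hlub
  obtain ⟨hA, hB⟩ := isLUB_prod.1 hlub
  refine ⟨?_, fun Q hQ => (guard_le_iff hℓ hL).2 fun A' B' hA' hB' => ?_⟩
  · rintro _ ⟨p, hp, rfl⟩
    exact (guard_le_iff hℓ hL).2 fun A' B' hA' hB' => guardFin_le_guard hℓ hL
      (hA'.trans (hlub.1 hp).1) (hB'.trans (hlub.1 hp).2)
  · obtain ⟨_, ⟨p, hp, rfl⟩, hpA⟩ := exists_le_of_isFinite_of_isLUB hL (hne.image Prod.fst)
      (hd.mono_comp (fun _ _ h => h.1)) hA A'.2 hA'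
    obtain ⟨_, ⟨q, hq, rfl⟩, hqB⟩ := exists_le_of_isFinite_of_isLUB hL (hne.image Prod.snd)
      (hd.mono_comp (fun _ _ h => h.2)) hB B'.2 hB'
    obtain ⟨r, hr, hpr, hqr⟩ := hd p hp q hq
    exact (guardFin_le_guard hℓ hL (hpA.trans hpr.1) (hqB.trans hqr.2)).trans (hQ ⟨r, hr, rfl⟩)

end guard

end Pom

/-! ### Least fixed points -/

/-- Kleene's fixed point theorem with a starting point `b` that need not be a least element: it is
enough that `b` lies below all values of `f`. -/
theorem exists_isLUB_iterate_isLeast_fixed {α : Type*} [PartialOrder α]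
    (hdcpo : ∀ D : Set α, D.Nonempty → DirectedOn (· ≤ ·) D → ∃ P, IsLUB D P) {f : α → α}
    (hf : ScottContinuous f) {b : α} (hb : ∀ x, b ≤ f x) :
    ∃ x, IsLUB (Set.range fun n : ℕ => f^[n] b) x ∧ IsLeast {y | f y = y} x := by
  have hmono : Monotone fun n : ℕ => f^[n] b := hf.monotone.monotone_iterate_of_le_map (hb b)
  have hdir := hmono.directed_le.directedOn_range
  obtain ⟨x, hx⟩ := hdcpo _ (Set.range_nonempty _) hdir
  refine ⟨x, hx, ?_, fun y hy => hx.2 ?_⟩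
  · refine (hf (Set.range_nonempty _) hdir hx).unique ⟨?_, fun y hy => hx.2 ?_⟩
    · rintro _ ⟨_, ⟨n, rfl⟩, rfl⟩
      exact hx.1 ⟨n + 1, Function.iterate_succ_apply' f n b⟩
    · rintro _ ⟨n, rfl⟩
      exact (hmono (Nat.le_succ n)).trans
        (hy ⟨_, ⟨n, rfl⟩, (Function.iterate_succ_apply' f n b).symm⟩)
  · rintro _ ⟨n, rfl⟩
    have hby : b ≤ y := (hb y).trans_eq hy
    calc f^[n] b ≤ f^[n] y := (hf.monotone.iterate n) hby
      _ = y := Function.iterate_fixed hy n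

end PomF

theorem mainTheorem7 {Node : Type*} [Infinite Node] {L : Type*} [PartialOrder L] [OrderBot L]
    (hL_dcpo : ∀ D : Set L, D.Nonempty → DirectedOn (· ≤ ·) D → ∃ l, IsLUB D l)
    (hL_fin : ∀ l : L, {m | m < l}.Finite)
    (ℓ : L) (hℓ : ℓ ≠ ⊥) :
    -- pomsets form a dcpo
    (∀ D : Set (PomF.Pom Node L), D.Nonempty → DirectedOn (· ≤ ·) D → ∃ P, IsLUB D P) ∧
    -- guarded choice is monotone on finite pomsets
    (∀ A A' B B' : {A : PomF.Pom Node L // A.IsFinite}, A.1 ≤ A'.1 → B.1 ≤ B'.1 →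
      PomF.Pom.guardFin ℓ hℓ A B ≤ PomF.Pom.guardFin ℓ hℓ A' B') ∧
    -- the suprema that define its extension to all pomsets exist
    (∀ (A' : {A : PomF.Pom Node L // A.IsFinite}) (B : PomF.Pom Node L),
      IsLUB (PomF.Pom.guardInner ℓ hℓ A' B) (PomF.Pom.sup (PomF.Pom.guardInner ℓ hℓ A' B))) ∧
    (∀ A B : PomF.Pom Node L,
      IsLUB (PomF.Pom.guardOuter ℓ hℓ A B) (PomF.Pom.guard ℓ hℓ A B)) ∧
    -- on finite pomsets the extension is the original operation
    (∀ A B : {A : PomF.Pom Node L // A.IsFinite},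
      PomF.Pom.guard ℓ hℓ A.1 B.1 = PomF.Pom.guardFin ℓ hℓ A B) ∧
    -- the extension is Scott continuous
    ScottContinuous (fun p : PomF.Pom Node L × PomF.Pom Node L => PomF.Pom.guard ℓ hℓ p.1 p.2) ∧
    -- loop functionals are Scott continuous and have least fixed points given by iteration
    (∀ (F : PomF.Pom Node L → PomF.Pom Node L) (K : PomF.Pom Node L), ScottContinuous F →
      ScottContinuous (fun X => PomF.Pom.guard ℓ hℓ (F X) K) ∧
      ∃ X : PomF.Pom Node L,
        IsLUB (Set.range fun n : ℕ =>
          (fun X => PomF.Pom.guard ℓ hℓ (F X) K)^[n] (PomF.Pom.singleton ⊥)) X ∧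
        IsLeast {Y | PomF.Pom.guard ℓ hℓ (F Y) K = Y} X) := by
  have hL : ∀ s : ℕ → L, Monotone s → ∃ n, ∀ k, n ≤ k → s k = s n := fun s hs =>
    PomF.PreLPOF.eventually_const_of_monotone hL_dcpo hL_fin s hs
  have hdcpo : ∀ D : Set (PomF.Pom Node L), D.Nonempty → DirectedOn (· ≤ ·) D → ∃ P, IsLUB D P :=
    fun D hne hD => (PomF.Pom.exists_isLUB_of_directedOn hL hne hD).imp fun _ h => h.1
  refine ⟨hdcpo, fun A A' B B' hA hB => PomF.Pom.guardFin_mono hℓ hA hB,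
    PomF.Pom.isLUB_guardInner hℓ hL, PomF.Pom.isLUB_guardOuter hℓ hL,
    PomF.Pom.guard_eq_guardFin hℓ hL, PomF.Pom.scottContinuous_guard hℓ hL, fun F K hF => ?_⟩
  have hΦ : ScottContinuous fun X => PomF.Pom.guard ℓ hℓ (F X) K :=
    (hF.prodMk (ScottContinuous.const K)).comp (PomF.Pom.scottContinuous_guard hℓ hL)
  exact ⟨hΦ, PomF.exists_isLUB_iterate_isLeast_fixed hdcpo hΦ fun X =>
    PomF.Pom.singleton_bot_le_guard hℓ hL (F X) K⟩
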